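/- A finite semigroup $S$ is called \emph{3-nilpotent} if it has a zero element $0$, $xyz=0$ for all $x,y,z\in S$, and $xy\neq 0$ for some $x,y\in S$. It is \emph{semirigid} if every automorphism of $S$ fixes every element of $S^2=\{xy : x,y\in S\}$. Two semigroups are \emph{equivalent} if they are isomorphic or anti-isomorphic. Let $\lambda\vdash r$ be an integer partition of $r\ge 1$ with parts $\lambda_1,\dots,\lambda_s$ (listed with multiplicity). Write $(a,b)$ for the greatest common divisor. Let $e_i=1$ if $\lambda_i$ is even and $e_i=0$ otherwise; $f_i=1$ if $\lambda_i\equiv 2\pmod 4$ and $f_i=0$ otherwise; $e_{ij}=1$ if at least one of $\lambda_i,\lambda_j$ is even and $e_{ij}=0$ otherwise. Put $$\beta(\lambda)=\sum_{1\le i,j\le s}(\lambda_i,\lambda_j),\qquad \eta(\lambda)=\sum_{i}(1-e_i+2f_i),$$ $$\zeta(\lambda)=\tfrac12\sum_i\{(1+e_i)(\lambda_i+1)-2(f_i+1)\}+\sum_{i<j}(1+e_{ij})(\lambda_i,\lambda_j),$$ and $w(\lambda)=\prod_{a} a^{\mu_a}\mu_a!$, where $a$ runs over the distinct parts of $\lambda$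 and $\mu_a$ is the multiplicity of $a$ in $\lambda$. Let $\left\{{p\atop q}\right\}$ be the Stirling number of the second kind. For $p,q\ge 0$ let $a_{p,q}$ be the number of partitions into $2q$ blocks of $Y\cup Y'$, where $Y$, $Y'$ are disjoint $p$-element sets matched by a bijection $y\mapsto y'$, that are invariant under the involution $y\leftrightarrow y'$ and in which $y$ and $y'$ never lie in the same block. For every $n$, let $$B(n)=\sum_{r=1}^{n-2}\ \sum_{\lambda\vdash r}\frac{\displaystyle\left\{{\beta(\lambda)+1\atop n-r}\right\}+\sum_{j=0}^{\zeta(\lambda)}\binom{\zeta(\lambda)}{j}\sum_{t=0}^{\min\{j,\lfloor (n-r-1)/2\rfloor\}}a_{j,t}\left\{{\zeta(\lambda)+\eta(\lambda)-j+1\atop n-r-2t}\right\}}{2\,w(\lambda)}.$$ Then the number of semirigid 3-nilpotent semigroups of cardinality $n$ up to equivalence is at most $B(n)$, and the number of all 3-nilpotent semigroups of cardinality $n$ up to equivalence is at least $B(n)$. -/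

import Mathlib

namespace NilpotentSemigroups

/-! ### Semigroups -/

/-- `S` is 3-nilpotent (strictly): it has a zero element `z`, all products of three elements
are equal to `z`, and some product of two elements is not. -/
def IsThreeNilpotent (S : Type*) [Semigroup S] : Prop :=
  ∃ z : S, (∀ x : S, z * x = z ∧ x * z = z) ∧ (∀ x y w : S, x * y * w = z) ∧
    ∃ x y : S, x * y ≠ z

/-- `S` is semirigid: every automorphism of `S` fixes every element of
`S² = {x * y | x, y ∈ S}`. -/
def IsSemirigid (S : Type*) [Semigroup S] : Prop :=
  ∀ φ : S ≃* S, ∀ x y : S, φ (x * y) = x * y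

/-- `S` and `T` are equivalent: isomorphic or anti-isomorphic. -/
def AreEquivalent (S T : Type*) [Semigroup S] [Semigroup T] : Prop :=
  Nonempty (S ≃* T) ∨ Nonempty (S ≃* Tᵐᵒᵖ)

theorem AreEquivalent.refl (S : Type*) [Semigroup S] : AreEquivalent S S :=
  Or.inl ⟨MulEquiv.refl S⟩

theorem AreEquivalent.symm {S T : Type*} [Semigroup S] [Semigroup T]
    (h : AreEquivalent S T) : AreEquivalent T S := by
  rcases h with ⟨⟨f⟩⟩ | ⟨⟨f⟩⟩
  · exact Or.inl ⟨f.symm⟩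
  · exact Or.inr ⟨(MulEquiv.opOp T).trans (MulEquiv.op f.symm)⟩

theorem AreEquivalent.trans {S T U : Type*} [Semigroup S] [Semigroup T] [Semigroup U]
    (h : AreEquivalent S T) (h' : AreEquivalent T U) : AreEquivalent S U := by
  rcases h with ⟨⟨f⟩⟩ | ⟨⟨f⟩⟩ <;> rcases h' with ⟨⟨g⟩⟩ | ⟨⟨g⟩⟩
  · exact Or.inl ⟨f.trans g⟩
  · exact Or.inr ⟨f.trans g⟩
  · exact Or.inr ⟨f.trans (MulEquiv.op g)⟩
  · exact Or.inl ⟨(f.trans (MulEquiv.op g)).trans (MulEquiv.opOp U).symm⟩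

/-- Equivalence, as an equivalence relation on the set of all semigroup structures on the
`n`-element set `Fin n`. -/
def equivalenceSetoid (n : ℕ) : Setoid (Semigroup (Fin n)) where
  r A B := @AreEquivalent (Fin n) (Fin n) A B
  iseqv :=
    { refl := fun A => @AreEquivalent.refl (Fin n) A
      symm := fun {A B} h => @AreEquivalent.symm (Fin n) (Fin n) A B h
      trans := fun {A B C} h h' => @AreEquivalent.trans (Fin n) (Fin n) (Fin n) A B C h h' }

/-- There are finitely many semigroup structures on `Fin n`, so the cardinalities below are
genuine counts. -/
instance finite_semigroup (n : ℕ) : Finite (Semigroup (Fin n)) :=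
  Finite.of_injective (fun A : Semigroup (Fin n) => (A.mul : Fin n → Fin n → Fin n))
    (fun _ _ h => Semigroup.ext h)

/-- The number of 3-nilpotent semigroups with `n` elements up to equivalence. -/
noncomputable def numThreeNilpotent (n : ℕ) : ℕ :=
  Nat.card (Quotient ((equivalenceSetoid n).comap
    (Subtype.val : {A : Semigroup (Fin n) // @IsThreeNilpotent (Fin n) A} → Semigroup (Fin n))))

/-- The number of semirigid 3-nilpotent semigroups with `n` elements up to equivalence. -/
noncomputable def numSemirigidThreeNilpotent (n : ℕ) : ℕ :=
  Nat.card (Quotient ((equivalenceSetoid n).comap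
    (Subtype.val :
      {A : Semigroup (Fin n) // @IsThreeNilpotent (Fin n) A ∧ @IsSemirigid (Fin n) A} →
        Semigroup (Fin n))))

/-! ### Functions of an integer partition -/

/-- The number of parts of the integer partition `l`, counted with multiplicity. -/
def numParts {r : ℕ} (l : r.Partition) : ℕ := (l.parts.sort (· ≥ ·)).length

/-- The `i`-th part of the integer partition `l`, parts being listed with multiplicity in
decreasing order. -/
def part {r : ℕ} (l : r.Partition) (i : Fin (numParts l)) : ℕ :=
  (l.parts.sort (· ≥ ·)).get i

/-- The sum of `gcd(λᵢ, λⱼ)` over all ordered pairs `(i, j)`. -/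
def beta {r : ℕ} (l : r.Partition) : ℕ :=
  ∑ i : Fin (numParts l), ∑ j : Fin (numParts l), Nat.gcd (part l i) (part l j)

/-- `1` if `a` is even and `0` otherwise. -/
def eInd (a : ℕ) : ℕ := if a % 2 = 0 then 1 else 0

/-- `1` if `a ≡ 2` modulo `4` and `0` otherwise. -/
def fInd (a : ℕ) : ℕ := if a % 4 = 2 then 1 else 0

/-- `1` if at least one of `a`, `b` is even and `0` otherwise. -/
def ePair (a b : ℕ) : ℕ := if a % 2 = 0 ∨ b % 2 = 0 then 1 else 0

/-- `ζ(λ)`. Each summand of the sum that is halved is a difference in natural numbers that is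
not truncated, and is even, so subtraction and division are exact (see `zeta_summand`). -/
def zeta {r : ℕ} (l : r.Partition) : ℕ :=
  (∑ i : Fin (numParts l), ((1 + eInd (part l i)) * (part l i + 1) - 2 * (fInd (part l i) + 1))) / 2
    + ∑ i : Fin (numParts l), ∑ j ∈ Finset.Ioi i,
        (1 + ePair (part l i) (part l j)) * Nat.gcd (part l i) (part l j)

theorem zeta_summand (a : ℕ) (ha : 0 < a) :
    2 * (fInd a + 1) ≤ (1 + eInd a) * (a + 1) ∧ 2 ∣ (1 + eInd a) * (a + 1) - 2 * (fInd a + 1) := by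
  unfold eInd fInd
  split_ifs <;> omega

/-- `η(λ)`. -/
def eta {r : ℕ} (l : r.Partition) : ℕ :=
  ∑ i : Fin (numParts l), ((1 - eInd (part l i)) + 2 * fInd (part l i))

/-- The weight `λ₁^μ₁ ⋯ λₜ^μₜ μ₁! ⋯ μₜ!`, where `λ₁, …, λₜ` are the distinct parts and
`μ₁, …, μₜ` their multiplicities. -/
def weight {r : ℕ} (l : r.Partition) : ℕ :=
  ∏ a ∈ l.parts.toFinset, a ^ l.parts.count a * (l.parts.count a).factorial

/-- `a_{p,q}`: with `Y`, `Y'` the two copies of `Fin p` in `Fin p ⊕ Fin p`, the number of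
partitions of `Y ∪ Y'` into `2q` blocks that are mapped to themselves by the involution
`y ↔ y'` and in which no block contains both `y` and `y'` for any `y`. -/
noncomputable def aNum (p q : ℕ) : ℕ :=
  Nat.card {P : Finpartition (Finset.univ : Finset (Fin p ⊕ Fin p)) //
    P.parts.card = 2 * q ∧
    P.parts.image (fun B => B.image Sum.swap) = P.parts ∧
    ∀ B ∈ P.parts, ∀ y : Fin p, ¬ (Sum.inl y ∈ B ∧ Sum.inr y ∈ B)}

/-- The self-dual term for `r` generators, cycle type `l ⊢ r` and order `n`; here
`n - r - 1` is the number `k` of non-zero products. -/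
noncomputable def selfDualTerm (n : ℕ) {r : ℕ} (l : r.Partition) : ℕ :=
  ∑ j ∈ Finset.range (zeta l + 1), (zeta l).choose j *
    ∑ t ∈ Finset.range (min j ((n - r - 1) / 2) + 1),
      aNum j t * Nat.stirlingSecond (zeta l + eta l - j + 1) (n - r - 2 * t)

/-- The bounding expression. -/
noncomputable def bound (n : ℕ) : ℚ :=
  ∑ r ∈ Finset.Icc 1 (n - 2), ∑ l : r.Partition,
    ((Nat.stirlingSecond (beta l + 1) (n - r) + selfDualTerm n l : ℕ) : ℚ) /
      (2 * (weight l : ℚ))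

end NilpotentSemigroups

namespace NilpotentSemigroups

/-! ### Counting equivalence relations -/

section Setoids

variable {W Q B : Type*}

/-! Count pairs (S, φ) with S 3-nilpotent on an `n`-element set and φ an automorphism or an
anti-automorphism. Permutations and the reversal of factors act together as a group of order 2·n!,
and orbit counting (`card_quotient_mul`) shows that the number of such pairs is 2·n! times the
number of classes. Now keep only the automorphisms that fix S² pointwise and the anti-automorphisms
whose square does. For semirigid S nothing is lost, because the square of an anti-automorphism is an
automorphism. For general S pairs can only be lost. So the restricted count lies between the two
orbit counts, and the theorem reduces to showing that it equals 2·n!·B(n), which is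
`sum_card_eq_bound`.

A 3-nilpotent S is a set A of non-products together with a surjective table F from pairs in A, and
one extra point `none` for the zero, onto the complement of A (`tableSemigroup_bijective`). An
(anti-)automorphism is determined by its restriction g to A, and the conditions on it concern only
the kernel of F (`card_isMulMapFixing`). With r = |A|, each kernel with n - r classes comes from (n
- r)! tables (`card_surjective_ker`), so it remains to count equivalence relations for each g.

For automorphisms the classes must be unions of cycles of g × g. There are β + 1 cycles including
`none`, which gives a Stirling number. For anti-automorphisms let τ(x, y) = (g y, g x). The classes
must be unions of cycles of τ², and the relation must be preserved by the involution that τ induces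
on these cycles. That involution has η + 1 fixed points and ζ two-element orbits
(`card_fixed_cycles_twist`, `card_cycles_twist_sq`).

Relations preserved by an involution are counted in `card_setoid_involutive`. Choose the j
two-element orbits whose members are inequivalent. No class meeting these can contain any other
point, so they carry a separating relation with 2t classes, counted by a_{j,t}. The other orbits act
as single points and carry an arbitrary relation with the remaining classes. Grouping g by cycle
type gives r!/w(λ) permutations each, and C(n, r)·(n - r)!·r! = n! clears the factorials. -/

instance finite_setoid [Finite W] : Finite (Setoid W) :=
  Finite.of_injective (fun s : Setoid W => (s.r : W → W → Prop)) fun _ _ h =>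
    Setoid.ext fun a b => by
    have := congrFun (congrFun h a) b
    exact Iff.of_eq this

/-- The number of equivalence classes. -/
noncomputable def numClasses (s : Setoid W) : ℕ := Nat.card (Quotient s)

theorem numClasses_comap_of_surjective {f : W → Q} (hf : Function.Surjective f) (s : Setoid Q) :
    numClasses (s.comap f) = numClasses s := by
  refine Nat.card_congr (Equiv.ofBijective
    (Quotient.map' (s₁ := s.comap f) (s₂ := s) f fun _ _ h => h) ⟨?_, ?_⟩)
  · rintro ⟨a⟩ ⟨b⟩ h
    exact Quotient.sound' (s₁ := s.comap f) (Quotient.exact' (s₁ := s) h)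
  · rintro ⟨b⟩
    obtain ⟨a, rfl⟩ := hf b
    exact ⟨Quotient.mk'' a, rfl⟩

theorem numClasses_comap_equiv (e : W ≃ Q) (s : Setoid Q) :
    numClasses (s.comap e) = numClasses s :=
  numClasses_comap_of_surjective e.surjective s

/-- Pulling back equivalence relations along an equivalence. -/
def setoidCongr (e : W ≃ Q) : Setoid Q ≃ Setoid W where
  toFun s := s.comap e
  invFun s := s.comap e.symm
  left_inv s := by ext a b; simp [Setoid.comap_rel]
  right_inv s := by ext a b; simp [Setoid.comap_rel]

/-- The equivalence relation on `Option W` obtained from one on `W` by putting the new point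
into a prescribed class, or into a class of its own. -/
def extendSetoid (s : Setoid W) (c : Option (Quotient s)) : Setoid (Option W) :=
  Setoid.ker fun x : Option W => x.elim c fun w => some (Quotient.mk s w)

theorem extendSetoid_some_some (s : Setoid W) (c : Option (Quotient s)) (a b : W) :
    extendSetoid s c (some a) (some b) ↔ s a b := by
  change some (Quotient.mk s a) = some (Quotient.mk s b) ↔ _
  rw [Option.some_inj, Quotient.eq]

theorem extendSetoid_none_some (s : Setoid W) (c : Option (Quotient s)) (a : W) :
    extendSetoid s c none (some a) ↔ c = some (Quotient.mk s a) :=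
  Iff.rfl

/-- A relation on `Option W` is recovered from its restriction to `W` and the class, if any, that
`none` joins. This is the combinatorial content of the Stirling recurrence. -/
theorem extendSetoid_bijective :
    Function.Bijective (fun p : Σ s : Setoid W, Option (Quotient s) => extendSetoid p.1 p.2) := by
  constructor
  · rintro ⟨s, c⟩ ⟨t, d⟩ h
    have hst : s = t := by
      ext a b
      rw [← extendSetoid_some_some s c, ← extendSetoid_some_some t d]
      exact Iff.of_eq (congrArg (fun u : Setoid (Option W) => u (some a) (some b)) h)
    subst hst
    congr 1
    have key : ∀ q, c = some q ↔ d = some q := by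
      rintro ⟨a⟩
      refine (extendSetoid_none_some s c a).symm.trans (Iff.trans ?_ (extendSetoid_none_some s d a))
      exact Iff.of_eq (congrArg (fun u : Setoid (Option W) => u none (some a)) h)
    exact Option.ext key
  · intro u
    by_cases h : ∃ a, u none (some a)
    · obtain ⟨a, ha⟩ := h
      refine ⟨⟨u.comap some, some (Quotient.mk _ a)⟩, ?_⟩
      have hn : ∀ b, extendSetoid (u.comap some) (some (Quotient.mk _ a)) none (some b) ↔
          u none (some b) := by
        intro b
        rw [extendSetoid_none_some, Option.some_inj, Quotient.eq, Setoid.comap_rel]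
        exact ⟨fun h => u.trans' ha h, fun h => u.trans' (u.symm' ha) h⟩
      ext x y
      rcases x with _ | x <;> rcases y with _ | y
      · simp
      · exact hn y
      · exact ⟨fun h => u.symm' ((hn x).1 (Setoid.symm' _ h)),
          fun h => Setoid.symm' _ ((hn x).2 (u.symm' h))⟩
      · exact extendSetoid_some_some _ _ _ _
    · refine ⟨⟨u.comap some, none⟩, ?_⟩
      have hn : ∀ b, extendSetoid (u.comap some) none none (some b) ↔ u none (some b) := by
        intro b
        rw [extendSetoid_none_some]
        exact ⟨fun h => by simp at h, fun hb => (h ⟨b, hb⟩).elim⟩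
      ext x y
      rcases x with _ | x <;> rcases y with _ | y
      · simp
      · exact hn y
      · exact ⟨fun h => u.symm' ((hn x).1 (Setoid.symm' _ h)),
          fun h => Setoid.symm' _ ((hn x).2 (u.symm' h))⟩
      · exact extendSetoid_some_some _ _ _ _

theorem numClasses_extendSetoid_none [Finite W] (s : Setoid W) :
    numClasses (extendSetoid s none) = numClasses s + 1 := by
  rw [numClasses, numClasses, ← Finite.card_option]
  refine Nat.card_congr (Setoid.quotientKerEquivOfSurjective _ ?_)
  rintro (_ | ⟨⟨a⟩⟩)
  · exact ⟨none, rfl⟩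
  · exact ⟨some a, rfl⟩

theorem numClasses_extendSetoid_some (s : Setoid W) (q : Quotient s) :
    numClasses (extendSetoid s (some q)) = numClasses s := by
  have h : extendSetoid s (some q) =
      Setoid.ker fun x : Option W => x.elim q fun w => Quotient.mk s w := by
    ext x y
    change x.elim (some q) (fun w => some (Quotient.mk s w)) =
      y.elim (some q) (fun w => some (Quotient.mk s w)) ↔ _
    rcases x with _ | x <;> rcases y with _ | y <;> simp [Setoid.ker_def]
  rw [h]
  refine Nat.card_congr (Setoid.quotientKerEquivOfSurjective _ ?_)
  rintro ⟨a⟩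
  exact ⟨some a, rfl⟩

theorem numClasses_extendSetoid [Finite W] (s : Setoid W) (c : Option (Quotient s)) :
    numClasses (extendSetoid s c) = numClasses s + if c = none then 1 else 0 := by
  rcases c with _ | q
  · simp [numClasses_extendSetoid_none]
  · simp [numClasses_extendSetoid_some]

/-- Either the new point joins one of `k + 1` existing classes, or it is alone and the old points
form `k` classes. -/
theorem card_setoid_option [Finite W] (k : ℕ) :
    Nat.card {s : Setoid (Option W) // numClasses s = k + 1} =
      (k + 1) * Nat.card {s : Setoid W // numClasses s = k + 1} +
        Nat.card {s : Setoid W // numClasses s = k} := by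
  classical
  have := Fintype.ofFinite (Setoid W)
  have e : {s : Setoid (Option W) // numClasses s = k + 1} ≃
      Σ s : Setoid W, {c : Option (Quotient s) // numClasses (extendSetoid s c) = k + 1} :=
    ((Equiv.ofBijective _ extendSetoid_bijective).subtypeEquiv (p := fun p =>
        numClasses (extendSetoid p.1 p.2) = k + 1) fun _ => Iff.rfl).symm.trans
      ⟨fun p => ⟨p.1.1, p.1.2, p.2⟩, fun p => ⟨⟨p.1, p.2.1⟩, p.2.2⟩, fun _ => rfl, fun _ => rfl⟩
  rw [Nat.card_congr e, Nat.card_sigma]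
  have h : ∀ s : Setoid W,
      Nat.card {c : Option (Quotient s) // numClasses (extendSetoid s c) = k + 1} =
        (k + 1) * (if numClasses s = k + 1 then 1 else 0) +
          (if numClasses s = k then 1 else 0) := by
    intro s
    have := Fintype.ofFinite (Quotient s)
    have hs : Fintype.card (Quotient s) = numClasses s := by
      rw [numClasses, Nat.card_eq_fintype_card]
    rw [Nat.card_eq_fintype_card, Fintype.card_subtype]
    change ((Finset.insertNone (Finset.univ : Finset (Quotient s))).filter _).card = _
    simp only [numClasses_extendSetoid]
    by_cases h1 : numClasses s = k + 1
    · have h2 : (Finset.insertNone (Finset.univ : Finset (Quotient s))).filter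
          (fun c => (numClasses s + if c = none then 1 else 0) = k + 1) =
          (Finset.univ : Finset (Quotient s)).map Function.Embedding.some := by
        ext c
        rcases c with _ | c <;> simp [h1]
      rw [h2]
      simp [h1, hs]
    · by_cases h3 : numClasses s = k
      · have h2 : (Finset.insertNone (Finset.univ : Finset (Quotient s))).filter
          (fun c => (numClasses s + if c = none then 1 else 0) = k + 1) = {none} := by
          ext c
          rcases c with _ | c <;> simp [h3]
        rw [h2]
        simp [h3]
      · simp only [h1, h3, if_false, mul_zero, add_zero, Finset.card_eq_zero]
        ext c
        rcases c with _ | c <;> simp [h1, h3]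
  simp only [h, Finset.sum_add_distrib, ← Finset.mul_sum]
  simp [Fintype.card_subtype]

theorem card_setoid_zero [Finite W] [Nonempty W] :
    Nat.card {s : Setoid W // numClasses s = 0} = 0 := by
  have : IsEmpty {s : Setoid W // numClasses s = 0} := ⟨fun s => by
    have h := s.2
    rw [numClasses, Finite.card_eq_zero_iff] at h
    exact h.elim (Quotient.mk _ (Classical.arbitrary W))⟩
  exact Nat.card_of_isEmpty

theorem card_setoid_of_isEmpty [IsEmpty W] (k : ℕ) :
    Nat.card {s : Setoid W // numClasses s = k} = Nat.stirlingSecond 0 k := by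
  have hq : ∀ s : Setoid W, numClasses s = 0 := fun s => by
    have : IsEmpty (Quotient s) := ⟨fun q => q.inductionOn fun a => isEmptyElim a⟩
    exact Nat.card_of_isEmpty
  have : Subsingleton (Setoid W) := ⟨fun s t => Setoid.ext fun a => isEmptyElim a⟩
  rcases k with _ | k
  · have : Nonempty {s : Setoid W // numClasses s = 0} := ⟨⟨⊥, hq _⟩⟩
    simp
  · simp [hq]

/-- Stirling numbers of the second kind count equivalence relations by number of classes. -/
theorem card_setoid_eq_stirlingSecond (W : Type*) [Finite W] (k : ℕ) :
    Nat.card {s : Setoid W // numClasses s = k} = Nat.stirlingSecond (Nat.card W) k := by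
  induction W using Finite.induction_empty_option generalizing k with
  | of_equiv e ih =>
    rw [← Nat.card_congr e, ← ih]
    exact Nat.card_congr ((setoidCongr e).subtypeEquiv fun s => by
      rw [← numClasses_comap_equiv e s]; rfl)
  | h_empty =>
    rw [card_setoid_of_isEmpty, Nat.card_of_isEmpty (α := PEmpty)]
  | h_option ih =>
    rw [Finite.card_option]
    rcases k with _ | k
    · rw [Nat.stirlingSecond_succ_zero, card_setoid_zero]
    · rw [card_setoid_option, ih, ih, Nat.stirlingSecond_succ_succ]

/-- Surjections with kernel satisfying `P` are labellings of the classes of such kernels. -/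
theorem card_surjective_ker [Finite W] [Finite B] (P : Setoid W → Prop) :
    Nat.card {F : W → B // Function.Surjective F ∧ P (Setoid.ker F)} =
      (Nat.card B).factorial * Nat.card {s : Setoid W // numClasses s = Nat.card B ∧ P s} := by
  classical
  have := Fintype.ofFinite {s : Setoid W // numClasses s = Nat.card B ∧ P s}
  have hb : Function.Bijective
      (fun p : Σ s : {s : Setoid W // numClasses s = Nat.card B ∧ P s}, (Quotient s.1 ≃ B) =>
        (⟨fun w => p.2 (Quotient.mk _ w), by
          have hk : Setoid.ker (fun w => p.2 (Quotient.mk _ w)) = p.1.1 := by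
            ext a b
            simp only [Setoid.ker_def, EmbeddingLike.apply_eq_iff_eq]
            exact Quotient.eq
          rw [hk]
          exact ⟨p.2.surjective.comp Quotient.mk_surjective, p.1.2.2⟩⟩ :
          {F : W → B // Function.Surjective F ∧ P (Setoid.ker F)})) := by
    constructor
    · rintro ⟨⟨s, hs⟩, e⟩ ⟨⟨t, ht⟩, f⟩ h
      have h' : ∀ w, e (Quotient.mk _ w) = f (Quotient.mk _ w) := fun w =>
        congrFun (congrArg Subtype.val h) w
      have hst : s = t := by
        ext a b
        rw [← Quotient.eq (r := s), ← Quotient.eq (r := t), ← e.apply_eq_iff_eq, h', h',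
          f.apply_eq_iff_eq]
      subst hst
      congr 1
      ext ⟨w⟩
      exact h' w
    · rintro ⟨F, hF, hP⟩
      refine ⟨⟨⟨Setoid.ker F, ?_, hP⟩, Setoid.quotientKerEquivOfSurjective F hF⟩, ?_⟩
      · exact Nat.card_congr (Setoid.quotientKerEquivOfSurjective F hF)
      · exact Subtype.ext (funext fun w => rfl)
  rw [← Nat.card_congr (Equiv.ofBijective _ hb), Nat.card_sigma]
  have hc : ∀ s : {s : Setoid W // numClasses s = Nat.card B ∧ P s},
      Nat.card (Quotient s.1 ≃ B) = (Nat.card B).factorial := by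
    intro s
    have := Fintype.ofFinite (Quotient s.1)
    have := Fintype.ofFinite B
    have e : Quotient s.1 ≃ B := Fintype.equivOfCardEq (by
      rw [← Nat.card_eq_fintype_card, ← Nat.card_eq_fintype_card]; exact s.2.1)
    rw [Nat.card_congr (Equiv.equivCongr e (Equiv.refl B)), Nat.card_perm]
  simp [hc, mul_comm]

/-- Equivalence relations coarser than `o` are equivalence relations on the quotient. -/
theorem card_setoid_ge (o : Setoid W) (N : ℕ) (P : Setoid W → Prop) :
    Nat.card {s : Setoid W // numClasses s = N ∧ o ≤ s ∧ P s} =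
      Nat.card {s : Setoid (Quotient o) // numClasses s = N ∧ P (s.comap (Quotient.mk o))} := by
  symm
  refine Nat.card_congr (Equiv.ofBijective (fun s => ⟨s.1.comap (Quotient.mk o), ?_, ?_, s.2.2⟩)
    ⟨?_, ?_⟩)
  · rw [numClasses_comap_of_surjective Quotient.mk_surjective, s.2.1]
  · intro a b h
    rw [Setoid.comap_rel, Quotient.sound h]
  · rintro ⟨s, hs⟩ ⟨t, ht⟩ h
    refine Subtype.ext (Setoid.ext ?_)
    rintro ⟨a⟩ ⟨b⟩
    exact Iff.of_eq (congrArg (fun u => u.1 a b) h)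
  · rintro ⟨s, hN, ho, hP⟩
    let t : Setoid (Quotient o) :=
      Setoid.ker (Quotient.map' (s₁ := o) (s₂ := s) id fun _ _ h => ho h)
    have ht : t.comap (Quotient.mk o) = s := by
      ext a b
      exact Quotient.eq (r := s)
    refine ⟨⟨t, ?_, ?_⟩, Subtype.ext ht⟩
    · rw [← numClasses_comap_of_surjective (Quotient.mk_surjective (s := o)), ht, hN]
    · rwa [ht]

end Setoids

/-! ### Equivalence relations invariant under an involution -/

section Involutions

variable {W Q Y F U V : Type*}

/-- `f` maps related elements to related elements. -/
def PreservedBy (s : Setoid W) (f : W → W) : Prop := ∀ a b, s a b → s (f a) (f b)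

/-- No class contains both copies of an element of `Y`. -/
def SeparatesCopies (s : Setoid (Y ⊕ Y)) : Prop := ∀ y, ¬ s (Sum.inl y) (Sum.inr y)

/-- Partitions and equivalence relations are interchangeable. This moves `aNum`, which is defined by
partitions, to the language of setoids used for all other counts. -/
theorem ker_part_bijective [Fintype W] [DecidableEq W] :
    Function.Bijective
      (fun P : Finpartition (Finset.univ : Finset W) => Setoid.ker P.part) := by
  classical
  constructor
  · intro P P' h
    have h1 : ∀ a, P.part a = P'.part a := by
      intro a
      ext b
      rw [P.mem_part_iff_part_eq_part (Finset.mem_univ _) (Finset.mem_univ _),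
        P'.mem_part_iff_part_eq_part (Finset.mem_univ _) (Finset.mem_univ _)]
      exact Iff.of_eq (congrArg (fun u : Setoid W => u b a) h)
    have h2 : ∀ P : Finpartition (Finset.univ : Finset W), P.parts = Finset.univ.image P.part := by
      intro P
      ext t
      simp only [Finset.mem_image, Finset.mem_univ, true_and]
      constructor
      · intro ht
        obtain ⟨x, -, hx⟩ := P.part_surjOn ht
        exact ⟨x, hx⟩
      · rintro ⟨x, rfl⟩
        simp
    refine Finpartition.ext ?_
    rw [h2 P, h2 P', funext h1]
  · intro s
    refine ⟨Finpartition.ofSetoid s, ?_⟩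
    ext a b
    change (Finpartition.ofSetoid s).part a = (Finpartition.ofSetoid s).part b ↔ _
    rw [← Finpartition.mem_part_iff_part_eq_part _ (Finset.mem_univ _) (Finset.mem_univ _),
      Finpartition.mem_part_ofSetoid_iff_rel]
    exact s.comm'

theorem numClasses_ker_part [Fintype W] [DecidableEq W]
    (P : Finpartition (Finset.univ : Finset W)) :
    numClasses (Setoid.ker P.part) = P.parts.card := by
  have h : Function.Surjective (fun a => (⟨P.part a, by simp⟩ : P.parts)) := by
    rintro ⟨t, ht⟩
    obtain ⟨x, -, hx⟩ := P.part_surjOn ht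
    exact ⟨x, Subtype.ext hx⟩
  have hk : Setoid.ker P.part = Setoid.ker (fun a => (⟨P.part a, by simp⟩ : P.parts)) := by
    ext a b
    simp [Setoid.ker_def]
  rw [numClasses, hk, Nat.card_congr (Setoid.quotientKerEquivOfSurjective _ h)]
  simp

/-- Since `f` is its own inverse, preserving the relation in one direction already forces each block
to map onto a whole block. -/
theorem image_parts_eq_iff [Fintype W] [DecidableEq W] {f : W → W} (hf : Function.Involutive f)
    (P : Finpartition (Finset.univ : Finset W)) :
    P.parts.image (fun B => B.image f) = P.parts ↔ PreservedBy (Setoid.ker P.part) f := by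
  constructor
  · intro h a b hab
    have hm : (P.part a).image f ∈ P.parts := h ▸ Finset.mem_image_of_mem _ (by simp)
    have h1 := P.part_eq_of_mem hm (Finset.mem_image_of_mem f (P.mem_part (Finset.mem_univ a)))
    have h2 := P.part_eq_of_mem hm (Finset.mem_image_of_mem f
      ((P.mem_part_iff_part_eq_part (Finset.mem_univ b) (Finset.mem_univ a)).2 hab.symm))
    exact h1.trans h2.symm
  · intro h
    have key : ∀ a, (P.part a).image f = P.part (f a) := by
      intro a
      have h' : ∀ a b, b ∈ P.part a → f b ∈ P.part (f a) := by
        intro a b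
        rw [P.mem_part_iff_part_eq_part (Finset.mem_univ _) (Finset.mem_univ _),
          P.mem_part_iff_part_eq_part (Finset.mem_univ _) (Finset.mem_univ _)]
        exact h b a
      ext b
      rw [Finset.mem_image]
      constructor
      · rintro ⟨c, hc, rfl⟩
        exact h' a c hc
      · intro hb
        refine ⟨f b, ?_, hf b⟩
        have := h' _ _ hb
        rwa [hf a] at this
    have hsub : ∀ B ∈ P.parts, B.image f ∈ P.parts := by
      intro B hB
      obtain ⟨x, -, rfl⟩ := P.part_surjOn hB
      rw [key]
      simp
    ext B
    rw [Finset.mem_image]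
    constructor
    · rintro ⟨C, hC, rfl⟩
      exact hsub C hC
    · intro hB
      refine ⟨B.image f, hsub B hB, ?_⟩
      rw [Finset.image_image, hf.comp_self, Finset.image_id]

theorem aNum_eq_card_setoid (p q : ℕ) :
    aNum p q = Nat.card {s : Setoid (Fin p ⊕ Fin p) //
      numClasses s = 2 * q ∧ PreservedBy s Sum.swap ∧ SeparatesCopies s} := by
  rw [aNum]
  refine Nat.card_congr ((Equiv.ofBijective _ ker_part_bijective).subtypeEquiv fun P => ?_)
  rw [Equiv.ofBijective_apply, numClasses_ker_part,
    image_parts_eq_iff (fun x => Sum.swap_swap x)]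
  refine and_congr_right fun _ => and_congr_right fun _ => ?_
  constructor
  · intro h y hy
    exact h (P.part (Sum.inl y)) (by simp) y ⟨by simp,
      (P.mem_part_iff_part_eq_part (Finset.mem_univ _) (Finset.mem_univ _)).2 hy.symm⟩
  · rintro h B hB y ⟨h1, h2⟩
    exact h y ((P.part_eq_of_mem hB h1).trans (P.part_eq_of_mem hB h2).symm)

theorem card_separating_setoid [Finite Y] (q : ℕ) :
    Nat.card {s : Setoid (Y ⊕ Y) //
      numClasses s = 2 * q ∧ PreservedBy s Sum.swap ∧ SeparatesCopies s} =
      aNum (Nat.card Y) q := by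
  rw [aNum_eq_card_setoid]
  have e : Y ≃ Fin (Nat.card Y) := Finite.equivFin Y
  refine Nat.card_congr ((setoidCongr (Equiv.sumCongr e e).symm).subtypeEquiv fun s => ?_)
  have hc : numClasses (setoidCongr (Equiv.sumCongr e e).symm s) = numClasses s :=
    numClasses_comap_equiv (Equiv.sumCongr e e).symm s
  rw [hc]
  refine and_congr_right fun _ => and_congr ?_ ?_
  · constructor
    · rintro h (a | a) (b | b) hab <;> exact h _ _ hab
    · intro h a b hab
      have := h (Equiv.sumCongr e e a) (Equiv.sumCongr e e b) (by
        change s ((Equiv.sumCongr e e).symm _) ((Equiv.sumCongr e e).symm _)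
        simpa only [Equiv.symm_apply_apply] using hab)
      have key : ∀ x : Y ⊕ Y,
          (Equiv.sumCongr e e).symm (Sum.swap (Equiv.sumCongr e e x)) = Sum.swap x := by
        rintro (x | x) <;> simp
      change s ((Equiv.sumCongr e e).symm _) ((Equiv.sumCongr e e).symm _) at this
      rwa [key, key] at this
  · constructor
    · intro h y
      exact h (e.symm y)
    · intro h y hy
      refine h (e y) ?_
      change s (Sum.inl (e.symm (e y))) (Sum.inr (e.symm (e y)))
      rwa [e.symm_apply_apply]

/-- The swap induces an involution on the classes. A class fixed by it would contain both copies of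
some element, so it has no fixed points. -/
theorem even_numClasses [Finite Y] {s : Setoid (Y ⊕ Y)} (h : PreservedBy s Sum.swap)
    (h' : SeparatesCopies s) : Even (numClasses s) := by
  classical
  have := Fintype.ofFinite (Quotient s)
  let f : Quotient s → Quotient s := Quotient.map' Sum.swap h
  have hf : Function.Involutive f := by
    rintro ⟨a⟩
    exact congrArg (Quotient.mk s) (Sum.swap_swap a)
  have hne : ∀ q, f q ≠ q := by
    rintro ⟨a⟩ hq
    have ha : s a.swap a := Quotient.exact hq
    rcases a with a | a
    · exact h' a (s.symm' ha)
    · exact h' a ha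
  have h2 : hf.toPerm ^ 2 ^ 1 = 1 := by
    ext q
    simpa [sq] using hf q
  -- The number of fixed points of an involution has the parity of the set; here it is zero.
  have hp := Equiv.Perm.card_compl_support_modEq (p := 2) (n := 1) h2
  have he : (hf.toPerm).supportᶜ = ∅ := by
    ext q
    simp [hne q]
  rw [he, Finset.card_empty, ← Nat.card_eq_fintype_card] at hp
  exact Nat.even_iff.2 hp.symm

/-- The disjoint union of two equivalence relations. -/
def sumSetoid (s : Setoid U) (t : Setoid V) : Setoid (U ⊕ V) :=
  Setoid.ker (Sum.map (Quotient.mk s) (Quotient.mk t))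

theorem sumSetoid_inl_inl (s : Setoid U) (t : Setoid V) (a b : U) :
    sumSetoid s t (Sum.inl a) (Sum.inl b) ↔ s a b := by
  change Sum.inl (Quotient.mk s a) = Sum.inl (Quotient.mk s b) ↔ _
  rw [Sum.inl.injEq, Quotient.eq]

theorem sumSetoid_inr_inr (s : Setoid U) (t : Setoid V) (a b : V) :
    sumSetoid s t (Sum.inr a) (Sum.inr b) ↔ t a b := by
  change Sum.inr (Quotient.mk t a) = Sum.inr (Quotient.mk t b) ↔ _
  rw [Sum.inr.injEq, Quotient.eq]

theorem not_sumSetoid_inl_inr (s : Setoid U) (t : Setoid V) (a : U) (b : V) :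
    ¬ sumSetoid s t (Sum.inl a) (Sum.inr b) := by
  change ¬ Sum.inl (Quotient.mk s a) = Sum.inr (Quotient.mk t b)
  simp

theorem not_sumSetoid_inr_inl (s : Setoid U) (t : Setoid V) (a : V) (b : U) :
    ¬ sumSetoid s t (Sum.inr a) (Sum.inl b) := by
  change ¬ Sum.inr (Quotient.mk t a) = Sum.inl (Quotient.mk s b)
  simp

theorem numClasses_sumSetoid [Finite U] [Finite V] (s : Setoid U) (t : Setoid V) :
    numClasses (sumSetoid s t) = numClasses s + numClasses t := by
  rw [numClasses, numClasses, numClasses, ← Nat.card_sum]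
  exact Nat.card_congr (Setoid.quotientKerEquivOfSurjective _
    (Sum.map_surjective.2 ⟨Quotient.mk_surjective, Quotient.mk_surjective⟩))

theorem eq_sumSetoid (u : Setoid (U ⊕ V)) (hu : ∀ a b, ¬ u (Sum.inl a) (Sum.inr b)) :
    u = sumSetoid (u.comap Sum.inl) (u.comap Sum.inr) := by
  ext x y
  rcases x with x | x <;> rcases y with y | y
  · exact (sumSetoid_inl_inl (u.comap Sum.inl) (u.comap Sum.inr) x y).symm
  · exact iff_of_false (hu _ _) (not_sumSetoid_inl_inr _ _ _ _)
  · exact iff_of_false (fun h => hu _ _ (u.symm' h)) (not_sumSetoid_inr_inl _ _ _ _)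
  · exact (sumSetoid_inr_inr (u.comap Sum.inl) (u.comap Sum.inr) x y).symm

/-- The involution exchanging the two copies of `Y` and fixing `F`. -/
def swapCopies : (Y ⊕ Y) ⊕ F → (Y ⊕ Y) ⊕ F := Sum.map Sum.swap id

/-! ### Splitting an invariant relation into its separated and non-separated pairs -/

section Collapse

variable (J : Finset Y) [DecidableEq Y]

/-- Identifies the two copies of each element of `Y` outside `J`. -/
def collapse : (Y ⊕ Y) ⊕ F → ({y // y ∈ J} ⊕ {y // y ∈ J}) ⊕ ({y // y ∉ J} ⊕ F)
  | Sum.inl (Sum.inl y) =>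
    if h : y ∈ J then Sum.inl (Sum.inl ⟨y, h⟩) else Sum.inr (Sum.inl ⟨y, h⟩)
  | Sum.inl (Sum.inr y) =>
    if h : y ∈ J then Sum.inl (Sum.inr ⟨y, h⟩) else Sum.inr (Sum.inl ⟨y, h⟩)
  | Sum.inr f => Sum.inr (Sum.inr f)

/-- A section of `collapse`. -/
def uncollapse : ({y // y ∈ J} ⊕ {y // y ∈ J}) ⊕ ({y // y ∉ J} ⊕ F) → (Y ⊕ Y) ⊕ F :=
  Sum.elim (fun u => Sum.inl (Sum.map Subtype.val Subtype.val u))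
    (Sum.map (fun y => Sum.inl y.1) id)

theorem collapse_uncollapse (x) : collapse J (F := F) (uncollapse J x) = x := by
  rcases x with (⟨y, hy⟩ | ⟨y, hy⟩) | (⟨y, hy⟩ | f) <;>
    first | rfl | simp [collapse, uncollapse, hy]

theorem collapse_swapCopies (x) :
    collapse J (F := F) (swapCopies x) = Sum.map Sum.swap id (collapse J x) := by
  rcases x with (y | y) | f
  · by_cases hy : y ∈ J <;> simp [collapse, swapCopies, hy]
  · by_cases hy : y ∈ J <;> simp [collapse, swapCopies, hy]
  · rfl

theorem uncollapse_collapse (x) :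
    uncollapse J (F := F) (collapse J x) = x ∨
      ∃ y ∉ J, uncollapse J (F := F) (collapse J x) = Sum.inl (Sum.inl y) ∧
        x = Sum.inl (Sum.inr y) := by
  rcases x with (y | y) | f
  · left; by_cases hy : y ∈ J <;> simp [collapse, uncollapse, hy]
  · by_cases hy : y ∈ J
    · left; simp [collapse, uncollapse, hy]
    · right; exact ⟨y, hy, by simp [collapse, uncollapse, hy], rfl⟩
  · left; rfl

/-- The relation on `(Y ⊕ Y) ⊕ F` whose separated copies are those in `J`. -/
def glue (s : Setoid ({y // y ∈ J} ⊕ {y // y ∈ J})) (t : Setoid ({y // y ∉ J} ⊕ F)) :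
    Setoid ((Y ⊕ Y) ⊕ F) := (sumSetoid s t).comap (collapse J)

theorem comap_uncollapse_glue (s : Setoid ({y // y ∈ J} ⊕ {y // y ∈ J}))
    (t : Setoid ({y // y ∉ J} ⊕ F)) : (glue J s t).comap (uncollapse J) = sumSetoid s t := by
  ext a b
  change sumSetoid s t (collapse J (uncollapse J a)) (collapse J (uncollapse J b)) ↔ _
  rw [collapse_uncollapse, collapse_uncollapse]

theorem numClasses_glue [Finite Y] [Finite F] (s : Setoid ({y // y ∈ J} ⊕ {y // y ∈ J}))
    (t : Setoid ({y // y ∉ J} ⊕ F)) : numClasses (glue J s t) = numClasses s + numClasses t := by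
  rw [glue, numClasses_comap_of_surjective (fun x => ⟨_, collapse_uncollapse J x⟩),
    numClasses_sumSetoid]

theorem glue_preservedBy {s : Setoid ({y // y ∈ J} ⊕ {y // y ∈ J})}
    (t : Setoid ({y // y ∉ J} ⊕ F)) (hs : PreservedBy s Sum.swap) :
    PreservedBy (glue J s t) swapCopies := by
  intro a b hab
  rw [glue, Setoid.comap_rel] at hab ⊢
  rw [collapse_swapCopies, collapse_swapCopies]
  generalize collapse J a = a' at *
  generalize collapse J b = b' at *
  rcases a' with a' | a' <;> rcases b' with b' | b'
  · exact (sumSetoid_inl_inl _ _ _ _).2 (hs _ _ ((sumSetoid_inl_inl _ _ _ _).1 hab))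
  · exact (not_sumSetoid_inl_inr _ _ _ _ hab).elim
  · exact (not_sumSetoid_inr_inl _ _ _ _ hab).elim
  · exact hab

theorem glue_copies {s : Setoid ({y // y ∈ J} ⊕ {y // y ∈ J})}
    (t : Setoid ({y // y ∉ J} ⊕ F)) (hs : SeparatesCopies s) (y : Y) :
    y ∈ J ↔ ¬ glue J s t (Sum.inl (Sum.inl y)) (Sum.inl (Sum.inr y)) := by
  rw [glue, Setoid.comap_rel]
  by_cases hy : y ∈ J
  · simp only [collapse, hy, dite_true, true_iff]
    rw [sumSetoid_inl_inl]
    exact hs _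
  · simp only [collapse, hy, dite_false, false_iff, not_not]
    exact Setoid.refl' _ _

/-- Separated points are never equivalent to the remaining points, so the relation is a disjoint
union of one on the copies over `J` and one in which the pairs outside `J` are collapsed. -/
theorem exists_glue (u : Setoid ((Y ⊕ Y) ⊕ F)) (hu : PreservedBy u swapCopies)
    (hJ : ∀ y, y ∈ J ↔ ¬ u (Sum.inl (Sum.inl y)) (Sum.inl (Sum.inr y))) :
    ∃ s t, PreservedBy s Sum.swap ∧ SeparatesCopies s ∧ glue J s t = u := by
  have hcross : ∀ a b, ¬ u.comap (uncollapse J) (Sum.inl a) (Sum.inr b) := by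
    intro a b hab
    rw [Setoid.comap_rel] at hab
    -- The point `b` is equivalent to its own image. If `a` were equivalent to `b`, applying the
    -- involution would make `a` equivalent to its partner, although `J` separates them.
    have hb : u (uncollapse J (Sum.inr b)) (swapCopies (uncollapse J (Sum.inr b))) := by
      rcases b with ⟨y, hy⟩ | f
      · exact not_not.1 (mt (hJ y).2 hy)
      · exact u.refl' _
    have ha := u.trans' (u.trans' hab hb) (u.symm' (hu _ _ hab))
    rcases a with ⟨y, hy⟩ | ⟨y, hy⟩
    · exact (hJ y).1 hy ha
    · exact (hJ y).1 hy (u.symm' ha)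
  refine ⟨(u.comap (uncollapse J)).comap Sum.inl, (u.comap (uncollapse J)).comap Sum.inr,
    ?_, ?_, ?_⟩
  · rintro (a | a) (b | b) hab <;> exact hu _ _ hab
  · rintro ⟨y, hy⟩ h
    exact (hJ y).1 hy h
  · rw [glue, ← eq_sumSetoid _ hcross]
    have key : ∀ x, u (uncollapse J (collapse J x)) x := by
      intro x
      rcases uncollapse_collapse J x with h | ⟨y, hy, h1, h2⟩
      · rw [h]
      · rw [h1, h2]
        exact not_not.1 (mt (hJ y).2 hy)
    ext a b
    rw [Setoid.comap_rel, Setoid.comap_rel]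
    exact ⟨fun h => u.trans' (u.symm' (key a)) (u.trans' h (key b)),
      fun h => u.trans' (key a) (u.trans' h (u.symm' (key b)))⟩

theorem card_setoid_separated [Finite Y] [Finite F] (N : ℕ) :
    Nat.card {u : Setoid ((Y ⊕ Y) ⊕ F) // (numClasses u = N ∧ PreservedBy u swapCopies) ∧
        ∀ y, y ∈ J ↔ ¬ u (Sum.inl (Sum.inl y)) (Sum.inl (Sum.inr y))} =
      Nat.card {p : Setoid ({y // y ∈ J} ⊕ {y // y ∈ J}) × Setoid ({y // y ∉ J} ⊕ F) //
        (PreservedBy p.1 Sum.swap ∧ SeparatesCopies p.1) ∧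
          numClasses p.1 + numClasses p.2 = N} := by
  symm
  refine Nat.card_congr (Equiv.ofBijective (fun p => ⟨glue J p.1.1 p.1.2,
    ⟨(numClasses_glue J _ _).trans p.2.2, glue_preservedBy J _ p.2.1.1⟩,
      glue_copies J _ p.2.1.2⟩) ⟨?_, ?_⟩)
  · rintro ⟨⟨s, t⟩, h⟩ ⟨⟨s', t'⟩, h'⟩ he
    have h1 : sumSetoid s t = sumSetoid s' t' := by
      rw [← comap_uncollapse_glue, ← comap_uncollapse_glue]
      exact congrArg (fun u => u.1.comap (uncollapse J)) he
    have h2 : s = s' := by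
      ext a b
      rw [← sumSetoid_inl_inl s t, h1, sumSetoid_inl_inl]
    have h3 : t = t' := by
      ext a b
      rw [← sumSetoid_inr_inr s t, h1, sumSetoid_inr_inr]
    subst h2 h3
    rfl
  · rintro ⟨u, ⟨hN, hu⟩, hJ⟩
    obtain ⟨s, t, hs, hs', h⟩ := exists_glue J u hu hJ
    refine ⟨⟨(s, t), ⟨hs, hs'⟩, ?_⟩, Subtype.ext h⟩
    rw [← hN, ← h, numClasses_glue]

end Collapse

theorem numClasses_le [Finite W] (s : Setoid W) : numClasses s ≤ Nat.card W :=
  Nat.card_le_card_of_surjective _ (Quotient.mk_surjective (s := s))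

theorem numClasses_pos [Finite W] [Nonempty W] (s : Setoid W) : 0 < numClasses s := by
  rw [numClasses, Nat.card_pos_iff]
  exact ⟨⟨Quotient.mk _ (Classical.arbitrary W)⟩, inferInstance⟩

/-- Sort by `t`, half the (even) number of classes of the first relation. It is at most `Nat.card Y`
since there are at most `2 * Nat.card Y` classes, and at most `(N - 1) / 2` since the nonempty `V`
takes at least one class. -/
theorem card_pair_setoid [Finite Y] [Finite V] [Nonempty V] (N : ℕ) :
    Nat.card {p : Setoid (Y ⊕ Y) × Setoid V //
        (PreservedBy p.1 Sum.swap ∧ SeparatesCopies p.1) ∧ numClasses p.1 + numClasses p.2 = N} =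
      ∑ t ∈ Finset.range (min (Nat.card Y) ((N - 1) / 2) + 1),
        aNum (Nat.card Y) t * Nat.stirlingSecond (Nat.card V) (N - 2 * t) := by
  classical
  have := Fintype.ofFinite (Setoid (Y ⊕ Y))
  have := Fintype.ofFinite (Setoid V)
  rw [Nat.card_eq_fintype_card, Fintype.card_subtype,
    Finset.card_eq_sum_card_fiberwise (f := fun p => numClasses p.1 / 2)
      (t := Finset.range (min (Nat.card Y) ((N - 1) / 2) + 1))]
  · refine Finset.sum_congr rfl fun t ht => ?_
    rw [← card_separating_setoid, ← card_setoid_eq_stirlingSecond, ← Nat.card_prod,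
      Nat.card_eq_fintype_card, ← Fintype.card_coe]
    have ht' : t ≤ Nat.card Y ∧ t ≤ (N - 1) / 2 := by
      simpa [Nat.lt_succ_iff] using ht
    have : Fintype.card ({s : Setoid (Y ⊕ Y) //
      numClasses s = 2 * t ∧ PreservedBy s Sum.swap ∧ SeparatesCopies s} ×
        {s : Setoid V // numClasses s = N - 2 * t}) =
        Fintype.card ↥((Finset.univ.filter fun s : Setoid (Y ⊕ Y) =>
          numClasses s = 2 * t ∧ PreservedBy s Sum.swap ∧ SeparatesCopies s) ×ˢ
        (Finset.univ.filter fun s : Setoid V => numClasses s = N - 2 * t)) := by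
      rw [Fintype.card_prod, Fintype.card_coe, Finset.card_product, Fintype.card_subtype,
        Fintype.card_subtype]
    rw [this, Fintype.card_coe, Fintype.card_coe]
    congr 1
    ext ⟨s, u⟩
    simp only [Finset.mem_filter, Finset.mem_univ, true_and, Finset.mem_product]
    have hu := numClasses_pos u
    constructor
    · rintro ⟨⟨⟨h1, h2⟩, h3⟩, h4⟩
      obtain ⟨c, hc⟩ := even_numClasses h1 h2
      refine ⟨⟨?_, h1, h2⟩, ?_⟩ <;> omega
    · rintro ⟨⟨h1, h2, h3⟩, h4⟩
      refine ⟨⟨⟨h2, h3⟩, ?_⟩, ?_⟩ <;> omega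
  · rintro ⟨s, u⟩ h
    simp only [Finset.coe_filter, Finset.mem_univ, true_and, Set.mem_ofPred_eq] at h
    have h1 := numClasses_le s
    have hu := numClasses_pos u
    rw [Nat.card_sum] at h1
    simp only [Finset.coe_range, Set.mem_Iio, Nat.lt_succ_iff, le_min_iff]
    constructor <;> omega

/-- Sort by the set `J` of separated pairs. The count for given `J` depends only on its size, whence
the binomial coefficient. -/
theorem card_setoid_swapCopies [Finite Y] [Finite F] [Nonempty F] (N : ℕ) :
    Nat.card {u : Setoid ((Y ⊕ Y) ⊕ F) // numClasses u = N ∧ PreservedBy u swapCopies} =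
      ∑ j ∈ Finset.range (Nat.card Y + 1), (Nat.card Y).choose j *
        ∑ t ∈ Finset.range (min j ((N - 1) / 2) + 1),
          aNum j t * Nat.stirlingSecond (Nat.card Y - j + Nat.card F) (N - 2 * t) := by
  classical
  have := Fintype.ofFinite Y
  have e : {u : Setoid ((Y ⊕ Y) ⊕ F) // numClasses u = N ∧ PreservedBy u swapCopies} ≃
      Σ J : Finset Y, {u : Setoid ((Y ⊕ Y) ⊕ F) // (numClasses u = N ∧ PreservedBy u swapCopies) ∧
        ∀ y, y ∈ J ↔ ¬ u (Sum.inl (Sum.inl y)) (Sum.inl (Sum.inr y))} :=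
    { toFun := fun u => ⟨Finset.univ.filter fun y =>
          ¬ u.1 (Sum.inl (Sum.inl y)) (Sum.inl (Sum.inr y)), u.1, u.2, by simp⟩
      invFun := fun p => ⟨p.2.1, p.2.2.1⟩
      left_inv := fun _ => rfl
      right_inv := by
        rintro ⟨J, u, hu, hJ⟩
        have : J = Finset.univ.filter fun y =>
          ¬ u (Sum.inl (Sum.inl y)) (Sum.inl (Sum.inr y)) := by
            ext y; simpa using hJ y
        subst this
        rfl }
  rw [Nat.card_congr e, Nat.card_sigma]
  have h : ∀ J : Finset Y, Nat.card {u : Setoid ((Y ⊕ Y) ⊕ F) //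
      (numClasses u = N ∧ PreservedBy u swapCopies) ∧
        ∀ y, y ∈ J ↔ ¬ u (Sum.inl (Sum.inl y)) (Sum.inl (Sum.inr y))} =
      ∑ t ∈ Finset.range (min J.card ((N - 1) / 2) + 1),
          aNum J.card t * Nat.stirlingSecond (Nat.card Y - J.card + Nat.card F) (N - 2 * t) := by
    intro J
    rw [card_setoid_separated, card_pair_setoid, Nat.card_sum]
    have h1 : Nat.card {y // y ∈ J} = J.card := by simp
    have h2 : Nat.card {y // y ∉ J} = Nat.card Y - J.card := by
      rw [Nat.card_eq_fintype_card, Nat.card_eq_fintype_card, Fintype.card_subtype_compl]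
      simp
    rw [h1, h2]
  simp only [h]
  rw [← Finset.powerset_univ, Finset.sum_powerset_apply_card (fun j =>
    ∑ t ∈ Finset.range (min j ((N - 1) / 2) + 1),
          aNum j t * Nat.stirlingSecond (Nat.card Y - j + Nat.card F) (N - 2 * t))]
  simp [Nat.card_eq_fintype_card]

/-- Involutions with equally many fixed points have the same cycle type, hence are conjugate. An
arbitrary bijection `e₀` is corrected by a conjugating permutation. -/
theorem exists_equiv_swapCopies [Finite Q] {f : Q → Q} (hf : Function.Involutive f) {z m : ℕ}
    (hm : Nat.card {q // f q = q} = m) (hz : Nat.card Q = 2 * z + m) :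
    ∃ e : (Fin z ⊕ Fin z) ⊕ Fin m ≃ Q, ∀ x, e (swapCopies x) = f (e x) := by
  classical
  have := Fintype.ofFinite Q
  have hs : Function.Involutive (swapCopies : (Fin z ⊕ Fin z) ⊕ Fin m → _) := by
    rintro ((_ | _) | _) <;> rfl
  have e₀ : (Fin z ⊕ Fin z) ⊕ Fin m ≃ Q := Fintype.equivOfCardEq (by
    rw [← Nat.card_eq_fintype_card (α := Q), hz]; simp; ring)
  have key : ∀ {σ : Equiv.Perm Q}, σ ^ 2 = 1 → Nat.card {q // σ q = q} = m →
      σ.cycleType = Multiset.replicate z 2 := by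
    intro σ h2 hfix
    have h := Equiv.Perm.cycleType_of_pow_prime_eq_one (p := 2) h2
    have hsum := σ.sum_cycleType
    rw [h, Multiset.sum_replicate, smul_eq_mul] at hsum
    have h3 : Nat.card {q // σ q = q} + σ.support.card = Nat.card Q := by
      rw [Nat.card_eq_fintype_card, Fintype.card_subtype, Nat.card_eq_fintype_card,
        ← Finset.card_univ, Equiv.Perm.support]
      exact Finset.card_filter_add_card_filter_not _
    have : σ.cycleType.card = z := by omega
    rw [h, this]
  let τ : Equiv.Perm Q := e₀.permCongr hs.toPerm
  have hτ : ∀ q, τ q = e₀ (swapCopies (e₀.symm q)) := fun q => rfl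
  have hc : IsConj τ hf.toPerm := by
    refine Equiv.Perm.isConj_of_cycleType_eq ((key ?_ ?_).trans (key ?_ ?_).symm)
    · ext q
      simp [sq, hτ, hs _]
    · have hb : Function.Bijective
          (fun i : Fin m => (⟨e₀ (Sum.inr i), by simp [hτ, swapCopies]⟩ : {q // τ q = q})) := by
        constructor
        · intro i j h
          simpa using h
        · rintro ⟨q, hq⟩
          obtain ⟨x, rfl⟩ := e₀.surjective q
          rw [hτ, e₀.symm_apply_apply, e₀.apply_eq_iff_eq] at hq
          rcases x with (x | x) | x
          · simp [swapCopies] at hq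
          · simp [swapCopies] at hq
          · exact ⟨x, rfl⟩
      rw [← Nat.card_congr (Equiv.ofBijective _ hb), Nat.card_fin]
    · ext q
      simpa [sq] using hf q
    · exact hm
  obtain ⟨c, hc⟩ := isConj_iff.1 hc
  refine ⟨e₀.trans c, fun x => ?_⟩
  have := congrArg (fun σ : Equiv.Perm Q => σ (c (e₀ x))) hc
  simpa [hτ] using this

theorem card_setoid_involutive [Finite Q] {f : Q → Q} (hf : Function.Involutive f) {z m : ℕ}
    (hm : Nat.card {q // f q = q} = m) (hz : Nat.card Q = 2 * z + m) (hm0 : 0 < m) (N : ℕ) :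
    Nat.card {u : Setoid Q // numClasses u = N ∧ PreservedBy u f} =
      ∑ j ∈ Finset.range (z + 1), z.choose j *
        ∑ t ∈ Finset.range (min j ((N - 1) / 2) + 1),
          aNum j t * Nat.stirlingSecond (z - j + m) (N - 2 * t) := by
  obtain ⟨e, he⟩ := exists_equiv_swapCopies hf hm hz
  have : Nonempty (Fin m) := ⟨⟨0, hm0⟩⟩
  have h := card_setoid_swapCopies (Y := Fin z) (F := Fin m) N
  simp only [Nat.card_fin] at h
  rw [← h]
  refine Nat.card_congr ((setoidCongr e).subtypeEquiv fun s => ?_)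
  have hc : numClasses (setoidCongr e s) = numClasses s := numClasses_comap_equiv e s
  rw [hc]
  refine and_congr_right fun _ => ?_
  constructor
  · intro h a b hab
    change s (e _) (e _)
    rw [he, he]
    exact h _ _ hab
  · intro h a b hab
    have := h (e.symm a) (e.symm b) (by
      change s (e _) (e _)
      simpa using hab)
    change s (e _) (e _) at this
    simpa [he] using this

end Involutions

/-! ### Counting orbits of permutations -/

section Orbits

open Function Equiv

variable {W α : Type*}

theorem zpow_apply_eq_self_iff (σ : Perm W) (w : W) (i : ℤ) :
    (σ ^ i) w = w ↔ (minimalPeriod σ w : ℤ) ∣ i :=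
  MulAction.zpow_smul_eq_iff_minimalPeriod_dvd (a := σ) (b := w)

theorem minimalPeriod_perm_pos [Finite W] (σ : Perm W) (w : W) : 0 < minimalPeriod σ w :=
  minimalPeriod_pos_of_mem_periodicPts
    (σ.injective.mem_periodicPts w)

theorem card_sameCycle [Finite W] (σ : Perm W) (w : W) :
    Nat.card {v // σ.SameCycle w v} = minimalPeriod σ w := by
  have := Fintype.ofFinite W
  classical
  have h := MulAction.minimalPeriod_eq_card (a := σ) (b := w)
  change minimalPeriod σ w = _ at h
  rw [h, ← Nat.card_eq_fintype_card]
  refine Nat.card_congr (Equiv.subtypeEquivRight fun v => ?_)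
  constructor
  · rintro ⟨i, hi⟩
    exact ⟨⟨σ ^ i, i, rfl⟩, hi⟩
  · rintro ⟨⟨_, i, rfl⟩, hi⟩
    exact ⟨i, hi⟩

theorem SameCycle.minimalPeriod_eq {σ : Perm W} {v w : W} (h : σ.SameCycle v w) :
    minimalPeriod σ v = minimalPeriod σ w := by
  obtain ⟨i, rfl⟩ := h
  rw [minimalPeriod_eq_minimalPeriod_iff]
  intro n
  have : ∀ u, IsPeriodicPt σ n u ↔ (σ ^ n) u = u := fun u => by
    rw [IsPeriodicPt, IsFixedPt, Perm.iterate_eq_pow]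
  rw [this, this, ← Perm.mul_apply, ← zpow_natCast, ← zpow_add, add_comm, zpow_add, Perm.mul_apply,
    EmbeddingLike.apply_eq_iff_eq]

/-- A sum over the cycles of `σ` as a weighted sum over points. -/
theorem sum_div_minimalPeriod [Fintype W] (σ : Perm W)
    [Fintype (Quotient (Perm.SameCycle.setoid σ))]
    (H : Quotient (Perm.SameCycle.setoid σ) → ℚ) :
    ∑ w, H (Quotient.mk _ w) / minimalPeriod σ w = ∑ q, H q := by
  classical
  rw [← Finset.sum_fiberwise (s := Finset.univ) (g := Quotient.mk (Perm.SameCycle.setoid σ))]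
  refine Finset.sum_congr rfl fun q _ => ?_
  obtain ⟨v, rfl⟩ := Quotient.mk_surjective q
  have hpos := minimalPeriod_perm_pos σ v
  have h1 : ∀ w ∈ Finset.univ.filter
      (fun w => Quotient.mk (Perm.SameCycle.setoid σ) w = Quotient.mk _ v),
      H (Quotient.mk _ w) / minimalPeriod σ w = H (Quotient.mk _ v) / minimalPeriod σ v := by
    intro w hw
    rw [Finset.mem_filter] at hw
    rw [hw.2, SameCycle.minimalPeriod_eq (Quotient.exact hw.2 : σ.SameCycle w v)]
  have h2 : (Finset.univ.filter
      (fun w => Quotient.mk (Perm.SameCycle.setoid σ) w = Quotient.mk _ v)).card =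
      minimalPeriod σ v := by
    rw [← card_sameCycle, Nat.card_eq_fintype_card, Fintype.card_subtype]
    congr 1
    ext w
    simp only [Finset.mem_filter, Finset.mem_univ, true_and]
    rw [Quotient.eq]
    exact Perm.sameCycle_comm
  rw [Finset.sum_congr rfl h1, Finset.sum_const, h2, nsmul_eq_mul]
  field_simp

theorem card_cycles [Fintype W] (σ : Perm W) :
    (Nat.card (Quotient (Perm.SameCycle.setoid σ)) : ℚ) = ∑ w, 1 / (minimalPeriod σ w : ℚ) := by
  classical
  have := Fintype.ofFinite (Quotient (Perm.SameCycle.setoid σ))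
  rw [sum_div_minimalPeriod σ (fun _ => 1)]
  simp [Nat.card_eq_fintype_card]

theorem card_cycles_subtype [Fintype W] (σ : Perm W)
    (R : Quotient (Perm.SameCycle.setoid σ) → Prop)
    [DecidablePred fun w => R (Quotient.mk _ w)] :
    (Nat.card {q // R q} : ℚ) =
      ∑ w, (if R (Quotient.mk _ w) then 1 else 0) / (minimalPeriod σ w : ℚ) := by
  classical
  have := Fintype.ofFinite (Quotient (Perm.SameCycle.setoid σ))
  have h := sum_div_minimalPeriod σ (fun q => if R q then 1 else 0)
  rw [Nat.card_eq_fintype_card, Fintype.card_subtype, Finset.card_filter]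
  push_cast
  rw [← h]
  refine Finset.sum_congr rfl fun w _ => ?_
  congr

/-- A part `a` stands for a cycle with `a` points, all of period `a`; fixed points supply the parts
equal to 1. Together with `card_cycles` this turns cycle counts into sums over the parts. -/
theorem sum_minimalPeriod [Fintype α] [DecidableEq α] (g : Perm α) (h : ℕ → ℚ) :
    ∑ x, h (minimalPeriod g x) = (g.partition.parts.map fun a : ℕ => (a : ℚ) * h a).sum := by
  classical
  rw [Perm.parts_partition, Multiset.map_add, Multiset.sum_add, Multiset.map_replicate,
    Multiset.sum_replicate, ← Finset.sum_add_sum_compl g.support]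
  congr 1
  · rw [Perm.cycleType_def, Multiset.map_map, ← Finset.sum_fiberwise_of_maps_to
      (t := g.cycleFactorsFinset) (g := fun x => g.cycleOf x)
      (fun x hx => Perm.cycleOf_mem_cycleFactorsFinset_iff.2 hx)]
    refine Finset.sum_congr rfl fun c hc => ?_
    have hf : g.support.filter (fun x => g.cycleOf x = c) = c.support := by
      ext x
      rw [Finset.mem_filter]
      constructor
      · rintro ⟨hx, rfl⟩
        exact Perm.mem_support_cycleOf_iff.2 ⟨Perm.SameCycle.refl _ _, hx⟩
      · intro hx
        exact ⟨Perm.mem_cycleFactorsFinset_support_le hc hx,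
          (Perm.cycle_is_cycleOf hx hc).symm⟩
    rw [hf]
    have hm : ∀ x ∈ c.support, h (minimalPeriod g x) = h c.support.card := by
      intro x hx
      rw [← card_sameCycle, Perm.cycle_is_cycleOf hx hc, Nat.card_eq_fintype_card,
        Fintype.card_subtype]
      congr 2
      ext y
      rw [Finset.mem_filter, Perm.mem_support_cycleOf_iff]
      simp [Perm.mem_cycleFactorsFinset_support_le hc hx]
    rw [Finset.sum_congr rfl hm]
    simp
  · have hm : ∀ x ∈ g.supportᶜ, h (minimalPeriod g x) = h 1 := by
      intro x hx
      rw [minimalPeriod_eq_one_iff_isFixedPt.2 (by simpa [IsFixedPt] using hx)]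
    rw [Finset.sum_congr rfl hm, Finset.sum_const, Finset.card_compl]
    simp

theorem sum_part {r : ℕ} (l : r.Partition) (f : ℕ → ℚ) :
    ∑ i, f (part l i) = (l.parts.map f).sum := by
  conv_rhs => rw [← Multiset.sort_eq l.parts (· ≥ ·)]
  rw [Multiset.map_coe, Multiset.sum_coe, ← Fin.sum_univ_fun_getElem]
  rfl

theorem sum_minimalPeriod_eq_sum_part [Fintype α] [DecidableEq α] (g : Perm α) (h : ℕ → ℚ) :
    ∑ x, h (minimalPeriod g x) =
      ∑ i, (part g.partition i : ℚ) * h (part g.partition i) := by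
  rw [sum_minimalPeriod, sum_part g.partition (fun a => (a : ℚ) * h a)]

theorem sum_minimalPeriod_pair [Fintype α] [DecidableEq α] (g : Perm α) (h : ℕ → ℕ → ℚ) :
    ∑ x : α × α, h (minimalPeriod g x.1) (minimalPeriod g x.2) =
      ∑ i, ∑ j, (part g.partition i : ℚ) * (part g.partition j) *
        h (part g.partition i) (part g.partition j) := by
  rw [Fintype.sum_prod_type]
  simp only [sum_minimalPeriod_eq_sum_part g (h _)]
  rw [sum_minimalPeriod_eq_sum_part g (fun a => ∑ j, (part g.partition j : ℚ) *
    h a (part g.partition j))]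
  simp only [Finset.mul_sum, mul_assoc]

theorem part_pos {r : ℕ} (l : r.Partition) (i : Fin (numParts l)) : 0 < part l i := by
  refine l.parts_pos ?_
  rw [← Multiset.mem_sort (· ≥ ·)]
  exact List.get_mem _ _

theorem minimalPeriod_optionCongr_some (σ : Perm W) (w : W) :
    minimalPeriod (optionCongr σ) (some w) = minimalPeriod σ w := by
  rw [minimalPeriod_eq_minimalPeriod_iff]
  intro n
  have h : ∀ n, (optionCongr σ)^[n] (some w) = some (σ^[n] w) := by
    intro n
    induction n with
    | zero => rfl
    | succ n ih => rw [iterate_succ_apply', ih, iterate_succ_apply']; rfl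
  rw [IsPeriodicPt, IsFixedPt, h, Option.some_inj]
  rfl

theorem minimalPeriod_optionCongr_none (σ : Perm W) :
    minimalPeriod (optionCongr σ) none = 1 :=
  minimalPeriod_eq_one_iff_isFixedPt.2 rfl

theorem card_cycles_optionCongr [Fintype W] (σ : Perm W) :
    (Nat.card (Quotient (Perm.SameCycle.setoid (optionCongr σ))) : ℚ) =
      1 + ∑ w, 1 / (minimalPeriod σ w : ℚ) := by
  rw [card_cycles, Fintype.sum_option, minimalPeriod_optionCongr_none]
  simp only [minimalPeriod_optionCongr_some, Nat.cast_one, div_one]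

/-- The period of a pair is the lcm of the periods, so the product of cycles of lengths a and b
splits into ab / lcm(a, b) = gcd(a, b) cycles. The extra 1 is the fixed point `none`. -/
theorem card_cycles_prodCongr [Fintype α] [DecidableEq α] (g : Perm α) :
    Nat.card (Quotient (Perm.SameCycle.setoid (optionCongr (prodCongr g g)))) =
      beta g.partition + 1 := by
  have h : ∀ x : α × α, 1 / (minimalPeriod (prodCongr g g) x : ℚ) =
      1 / (Nat.lcm (minimalPeriod g x.1) (minimalPeriod g x.2) : ℚ) := by
    intro x
    rw [← minimalPeriod_prodMap]
    rfl
  have key := card_cycles_optionCongr (prodCongr g g)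
  simp only [h] at key
  rw [sum_minimalPeriod_pair g (fun a b => 1 / (Nat.lcm a b : ℚ))] at key
  have h2 : ∀ i j, (part g.partition i : ℚ) * (part g.partition j) *
        (1 / (Nat.lcm (part g.partition i) (part g.partition j) : ℚ)) =
        Nat.gcd (part g.partition i) (part g.partition j) := by
    intro i j
    have hp := Nat.lcm_pos (part_pos g.partition i) (part_pos g.partition j)
    have := Nat.gcd_mul_lcm (part g.partition i) (part g.partition j)
    field_simp
    rw [← Nat.cast_mul, ← this]
    push_cast
    ring
  simp only [h2] at key
  have hb : (beta g.partition : ℚ) = ∑ i, ∑ j,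
      (Nat.gcd (part g.partition i) (part g.partition j) : ℚ) := by
    simp [beta]
  rw [← hb, add_comm] at key
  exact_mod_cast key

/-- The permutation `(x, y) ↦ (g y, g x)`. -/
def twist (g : Perm α) : Perm (α × α) := (Equiv.prodComm α α).trans (prodCongr g g)

theorem twist_apply (g : Perm α) (x y : α) : twist g (x, y) = (g y, g x) := rfl

/-- Under the square of a permutation a point of period a has period a / gcd(a, 2). Dividing by the
lcm therefore gives the number of cycles of g² × g² on a product of two cycles of g. -/
theorem mul_gcd_two (a b : ℕ) :
    a * b = (1 + ePair a b) * Nat.gcd a b * Nat.lcm (a / Nat.gcd a 2) (b / Nat.gcd b 2) := by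
  have h1 : ∀ c d : ℕ, Nat.gcd c d * Nat.lcm c d = c * d := Nat.gcd_mul_lcm
  have hodd : ∀ {c : ℕ}, c % 2 = 1 → Nat.gcd c 2 = 1 := fun {c} hc => by
    rw [Nat.gcd_comm, Nat.gcd_rec, hc]; rfl
  have heven : ∀ {c : ℕ}, c % 2 = 0 → Nat.gcd c 2 = 2 := fun {c} hc => by
    rw [Nat.gcd_comm, Nat.gcd_rec, hc]; rfl
  have hmix : ∀ c d : ℕ, d % 2 = 1 → Nat.gcd (2 * c) d = Nat.gcd c d := fun c d hd =>
    Nat.Coprime.gcd_mul_left_cancel c (by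
      rw [Nat.coprime_comm, Nat.coprime_iff_gcd_eq_one, hodd hd])
  rcases Nat.mod_two_eq_zero_or_one a with ha2 | ha2 <;>
    rcases Nat.mod_two_eq_zero_or_one b with hb2 | hb2
  · obtain ⟨c, rfl⟩ := Nat.dvd_of_mod_eq_zero ha2
    obtain ⟨d, rfl⟩ := Nat.dvd_of_mod_eq_zero hb2
    rw [heven ha2, heven hb2, Nat.mul_div_cancel_left _ two_pos, Nat.mul_div_cancel_left _ two_pos,
      Nat.gcd_mul_left, ePair, if_pos (Or.inl ha2)]
    have := h1 c d
    nlinarith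
  · obtain ⟨c, rfl⟩ := Nat.dvd_of_mod_eq_zero ha2
    rw [heven ha2, hodd hb2, Nat.mul_div_cancel_left _ two_pos, Nat.div_one, hmix _ _ hb2, ePair,
      if_pos (Or.inl ha2), mul_assoc, mul_assoc, h1]
  · obtain ⟨d, rfl⟩ := Nat.dvd_of_mod_eq_zero hb2
    rw [hodd ha2, heven hb2, Nat.mul_div_cancel_left _ two_pos, Nat.div_one, Nat.gcd_comm,
      hmix _ _ ha2, Nat.gcd_comm, ePair, if_pos (Or.inr hb2), mul_assoc, h1]
    ring
  · rw [hodd ha2, hodd hb2, Nat.div_one, Nat.div_one, ePair, if_neg (by omega)]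
    simp [h1]

/-- The gcd sum is symmetric, so its off-diagonal part is twice the sum over i < j. On the diagonal,
η is exactly what makes up for the subtraction in ζ. -/
theorem two_mul_zeta_add_eta {r : ℕ} (l : r.Partition) :
    2 * zeta l + eta l =
      ∑ i, ∑ j, (1 + ePair (part l i) (part l j)) * Nat.gcd (part l i) (part l j) := by
  set h : Fin (numParts l) → Fin (numParts l) → ℕ := fun i j =>
    (1 + ePair (part l i) (part l j)) * Nat.gcd (part l i) (part l j) with hh
  have hsymm : ∀ i j, h j i = h i j := fun i j => by
    simp only [hh, ePair, Nat.gcd_comm (part l j), or_comm]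
  have hoff : 2 * ∑ i, ∑ j ∈ Finset.Ioi i, h i j + ∑ i, h i i = ∑ i, ∑ j, h i j := by
    have h1 := Finset.sum_sum_Ioi_add_eq_sum_sum_off_diag h
    simp only [hsymm, ← two_mul, ← Finset.mul_sum] at h1
    rw [h1, ← Finset.sum_add_distrib]
    exact Finset.sum_congr rfl fun i _ => Finset.sum_compl_add_sum {i} (h i) ▸ by simp
  have hdiag : 2 * ((∑ i, ((1 + eInd (part l i)) * (part l i + 1) -
      2 * (fInd (part l i) + 1))) / 2) + eta l = ∑ i, h i i := by
    rw [Nat.mul_div_cancel' (Finset.dvd_sum fun i _ => (zeta_summand _ (part_pos l i)).2), eta,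
      ← Finset.sum_add_distrib]
    refine Finset.sum_congr rfl fun i _ => ?_
    have hp := part_pos l i
    simp only [hh, Nat.gcd_self, eInd, fInd, ePair, or_self]
    split_ifs <;> omega
  rw [zeta, ← hoff, ← hdiag]
  ring

/-- The map induced by `σ` on the cycles of `σ ^ 2`. -/
def cycleMap (σ : Perm W) :
    Quotient (Perm.SameCycle.setoid (σ ^ 2)) → Quotient (Perm.SameCycle.setoid (σ ^ 2)) :=
  Quotient.map' σ (by
    rintro a b ⟨i, rfl⟩
    refine ⟨i, ?_⟩
    rw [← zpow_natCast, ← zpow_mul, ← Perm.mul_apply, ← Perm.mul_apply]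
    congr 1
    exact (Commute.zpow_self σ _).eq)

theorem cycleMap_involutive (σ : Perm W) : Involutive (cycleMap σ) := by
  rintro ⟨a⟩
  refine Quotient.sound (s := Perm.SameCycle.setoid (σ ^ 2)) ?_
  refine ⟨-1, ?_⟩
  simp [sq]

/-- The image of `w` lies in the same cycle of `σ ^ 2` exactly when an even power of `σ` takes `σ w`
back to `w`. -/
theorem cycleMap_eq_self_iff (σ : Perm W) (w : W) :
    cycleMap σ (Quotient.mk _ w) = Quotient.mk _ w ↔ ∃ i : ℤ, (σ ^ (2 * i + 1)) w = w := by
  have : cycleMap σ (Quotient.mk _ w) = Quotient.mk _ w ↔ (σ ^ 2).SameCycle (σ w) w :=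
    Quotient.eq (r := Perm.SameCycle.setoid (σ ^ 2))
  rw [this]
  refine exists_congr fun i => ?_
  rw [zpow_add, zpow_mul, zpow_one]
  rfl

theorem twist_zpow_apply (g : Perm α) (x y : α) (i : ℤ) :
    (twist g ^ (2 * i + 1)) (x, y) = ((g ^ (2 * i + 1)) y, (g ^ (2 * i + 1)) x) := by
  have h : ∀ i : ℤ, ∀ z : α × α,
      (twist g ^ (2 * i)) z = ((g ^ (2 * i)) z.1, (g ^ (2 * i)) z.2) := by
    intro i
    induction i with
    | zero => intro z; rfl
    | succ i ih =>
      intro z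
      rw [mul_add, mul_one, zpow_add, zpow_add, Perm.mul_apply, ih]
      rfl
    | pred i ih =>
      intro z
      rw [mul_sub, mul_one, sub_eq_add_neg, zpow_add, zpow_add, Perm.mul_apply, ih]
      rfl
  rw [zpow_add, zpow_add, Perm.mul_apply, zpow_one, twist_apply, h]
  rfl

/-- For odd k the condition says that g^k exchanges x and y, so the period a of x divides 2k. If a
is odd then a divides k and y = x. If a ≡ 2 mod 4 then k is an odd multiple of a/2. If 4 divides a
no odd k exists. -/
theorem exists_twist_zpow_iff (g : Perm α) (x y : α) :
    (∃ i : ℤ, (twist g ^ (2 * i + 1)) (x, y) = (x, y)) ↔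
      (minimalPeriod g x % 2 = 1 ∧ y = x) ∨
        (minimalPeriod g x % 4 = 2 ∧ y = (g ^ (minimalPeriod g x / 2)) x) := by
  simp only [twist_zpow_apply, Prod.mk.injEq]
  set a := minimalPeriod g x with ha
  have hz : ∀ i : ℤ, (g ^ i) x = x ↔ (a : ℤ) ∣ i := fun i => zpow_apply_eq_self_iff g x i
  constructor
  · rintro ⟨i, h1, h2⟩
    have h3 : (a : ℤ) ∣ (2 * i + 1) + (2 * i + 1) := by
      rw [← hz, zpow_add, Perm.mul_apply, h2, h1]
    rcases Nat.mod_two_eq_zero_or_one a with h | h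
    · right
      obtain ⟨c, hc⟩ := h3
      have h4 : a % 4 = 2 := by
        by_contra h4
        have : a % 4 = 0 := by omega
        obtain ⟨b, hb⟩ := Nat.dvd_of_mod_eq_zero this
        rw [hb] at hc
        push_cast at hc
        have : 2 * i + 1 = 2 * (b * c) := by linarith
        omega
      refine ⟨h4, ?_⟩
      obtain ⟨b, hb⟩ := Nat.dvd_of_mod_eq_zero h
      have hc' : 2 * i + 1 = b * c := by
        rw [hb] at hc; push_cast at hc; linarith
      have hodd : Odd c := by
        have : Odd ((b : ℤ) * c) := ⟨i, hc'.symm⟩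
        exact (Int.odd_mul.1 this).2
      obtain ⟨d, hd⟩ := hodd
      have : (2 * i + 1 : ℤ) = ((a / 2 : ℕ) : ℤ) + a * d := by
        rw [hc', hd, hb, Nat.mul_div_cancel_left _ two_pos]
        push_cast
        ring
      rw [← h2, this, zpow_add, Perm.mul_apply, (hz _).2 (Dvd.intro _ rfl), zpow_natCast]
    · left
      refine ⟨h, ?_⟩
      rw [← h2, hz]
      rw [← two_mul] at h3
      refine IsCoprime.dvd_of_dvd_mul_left ?_ h3
      exact_mod_cast Nat.isCoprime_iff_coprime.2 ((Nat.coprime_two_right).2 (Nat.odd_iff.2 h))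
  · rintro (⟨h, rfl⟩ | ⟨h, rfl⟩)
    -- The odd exponent is `a` itself.
    · refine ⟨(a / 2 : ℕ), ?_⟩
      have : (2 * ((a / 2 : ℕ) : ℤ) + 1) = a := by omega
      rw [this, hz]
      exact ⟨dvd_rfl, dvd_rfl⟩
    -- The odd exponent is `a / 2`.
    · refine ⟨(a / 4 : ℕ), ?_⟩
      have : (2 * ((a / 4 : ℕ) : ℤ) + 1) = (a / 2 : ℕ) := by omega
      rw [this, zpow_natCast, ← Perm.mul_apply, ← pow_add]
      have h2 : a / 2 + a / 2 = a := by omega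
      rw [h2]
      refine ⟨?_, rfl⟩
      rw [← zpow_natCast, hz]

/-- Reversing twice restores the order, so the square of `twist g` is g² × g². -/
theorem minimalPeriod_twist_sq (g : Perm α) (x : α × α) :
    minimalPeriod (twist g ^ 2 : Perm (α × α)) x =
      Nat.lcm (minimalPeriod g x.1 / Nat.gcd (minimalPeriod g x.1) 2)
        (minimalPeriod g x.2 / Nat.gcd (minimalPeriod g x.2) 2) := by
  rw [← minimalPeriod_iterate_eq_div_gcd two_ne_zero,
    ← minimalPeriod_iterate_eq_div_gcd two_ne_zero,
    ← minimalPeriod_prodMap]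
  rfl

theorem optionCongr_sq (σ : Perm W) : (optionCongr σ) ^ 2 = optionCongr (σ ^ 2) := by
  ext1 x
  rcases x with _ | x <;> rfl

theorem minimalPeriod_optionCongr_sq_some (σ : Perm W) (w : W) :
    minimalPeriod ((optionCongr σ) ^ 2 : Perm (Option W)) (some w) =
      minimalPeriod (σ ^ 2 : Perm W) w := by
  rw [optionCongr_sq, minimalPeriod_optionCongr_some]

theorem minimalPeriod_optionCongr_sq_none (σ : Perm W) :
    minimalPeriod ((optionCongr σ) ^ 2 : Perm (Option W)) none = 1 := by
  rw [optionCongr_sq, minimalPeriod_optionCongr_none]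

theorem card_cycles_twist_sq [Fintype α] [DecidableEq α] (g : Perm α) :
    Nat.card (Quotient (Perm.SameCycle.setoid ((optionCongr (twist g)) ^ 2))) =
      2 * zeta g.partition + (eta g.partition + 1) := by
  have key := card_cycles_optionCongr (twist g ^ 2)
  simp only [minimalPeriod_twist_sq] at key
  rw [sum_minimalPeriod_pair g (fun a b =>
    1 / (Nat.lcm (a / Nat.gcd a 2) (b / Nat.gcd b 2) : ℚ))] at key
  have h2 : ∀ i j, (part g.partition i : ℚ) * (part g.partition j) *
        (1 / (Nat.lcm (part g.partition i / Nat.gcd (part g.partition i) 2)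
          (part g.partition j / Nat.gcd (part g.partition j) 2) : ℚ)) =
        ((1 + ePair (part g.partition i) (part g.partition j)) *
          Nat.gcd (part g.partition i) (part g.partition j) : ℕ) := by
    intro i j
    have h := mul_gcd_two (part g.partition i) (part g.partition j)
    have hp : 0 < Nat.lcm (part g.partition i / Nat.gcd (part g.partition i) 2)
          (part g.partition j / Nat.gcd (part g.partition j) 2) := by
      by_contra h0
      rw [Nat.eq_zero_of_not_pos h0, mul_zero] at h
      exact (Nat.mul_pos (part_pos g.partition i) (part_pos g.partition j)).ne' h
    rw [mul_one_div, div_eq_iff (by positivity), ← Nat.cast_mul, ← Nat.cast_mul, ← h]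
  simp only [h2] at key
  have h3 := two_mul_zeta_add_eta g.partition
  rw [optionCongr_sq]
  have h4 : (Nat.card (Quotient (Perm.SameCycle.setoid (optionCongr (twist g ^ 2)))) : ℚ) =
      ((1 + ∑ i, ∑ j, (1 + ePair (part g.partition i) (part g.partition j)) *
          Nat.gcd (part g.partition i) (part g.partition j) : ℕ) : ℚ) := by
    rw [key]; push_cast; rfl
  have h5 := Nat.cast_injective h4
  omega

theorem cycleMap_optionCongr_some (σ : Perm W) (w : W) :
    cycleMap (optionCongr σ) (Quotient.mk _ (some w)) = Quotient.mk _ (some w) ↔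
      ∃ i : ℤ, (σ ^ (2 * i + 1)) w = w := by
  rw [cycleMap_eq_self_iff]
  refine exists_congr fun i => ?_
  rw [zpow_apply_eq_self_iff, zpow_apply_eq_self_iff, minimalPeriod_optionCongr_some]

/-- Weight each pair by the reciprocal of its period under the square of `twist g`. A point x of
period a has one admissible partner of weight 1/a if a is odd, one of weight 2/a if a ≡ 2 mod 4, and
none if 4 divides a. Summing over the points of each cycle gives η, and `none` adds 1. -/
theorem card_fixed_cycles_twist [Fintype α] [DecidableEq α] (g : Perm α) :
    Nat.card {q // cycleMap (optionCongr (twist g)) q = q} = eta g.partition + 1 := by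
  classical
  have key := card_cycles_subtype ((optionCongr (twist g)) ^ 2)
    (fun q => cycleMap (optionCongr (twist g)) q = q)
  rw [Fintype.sum_option, if_pos (by rfl), minimalPeriod_optionCongr_sq_none] at key
  simp only [minimalPeriod_optionCongr_sq_some, minimalPeriod_twist_sq,
    Nat.cast_one, div_one] at key
  rw [Fintype.sum_prod_type] at key
  have h : ∀ x : α, ∑ y : α,
      (if cycleMap (optionCongr (twist g)) (Quotient.mk _ (some (x, y))) =
        Quotient.mk _ (some (x, y)) then (1 : ℚ) else 0) /
        (Nat.lcm (minimalPeriod g x / Nat.gcd (minimalPeriod g x) 2)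
          (minimalPeriod g y / Nat.gcd (minimalPeriod g y) 2) : ℚ) =
      (((1 - eInd (minimalPeriod g x)) + 2 * fInd (minimalPeriod g x) : ℕ) : ℚ) /
        minimalPeriod g x := by
    intro x
    have hpos := minimalPeriod_perm_pos g x
    have hiff : ∀ y, cycleMap (optionCongr (twist g)) (Quotient.mk _ (some (x, y))) =
        Quotient.mk _ (some (x, y)) ↔ _ := fun y =>
      (cycleMap_optionCongr_some (twist g) (x, y)).trans (exists_twist_zpow_iff g x y)
    simp only [hiff]
    have hlt := Nat.mod_lt (minimalPeriod g x) (show 0 < 4 by norm_num)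
    have hcases : minimalPeriod g x % 2 = 1 ∨ minimalPeriod g x % 4 = 2 ∨
      minimalPeriod g x % 4 = 0 := by omega
    rcases hcases with h | h | h
    · have h4 : ¬ minimalPeriod g x % 4 = 2 := by omega
      rw [Finset.sum_eq_single x]
      · have hg : Nat.gcd (minimalPeriod g x) 2 = 1 := by
          rw [Nat.gcd_comm, Nat.gcd_rec, h]; rfl
        simp [h, eInd, fInd, h4, hg]
      · intro y _ hy
        simp [h, h4, hy]
      · simp
    · have h4 : ¬ minimalPeriod g x % 2 = 1 := by omega
      have h5 : minimalPeriod g x % 2 = 0 := by omega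
      rw [Finset.sum_eq_single ((g ^ (minimalPeriod g x / 2)) x)]
      · have hg : Nat.gcd (minimalPeriod g x) 2 = 2 := by
          rw [Nat.gcd_comm, Nat.gcd_rec, h5]; rfl
        have hm : minimalPeriod g ((g ^ (minimalPeriod g x / 2)) x) = minimalPeriod g x :=
          (SameCycle.minimalPeriod_eq (⟨(minimalPeriod g x / 2 : ℕ), by rw [zpow_natCast]⟩)).symm
        obtain ⟨b, hb⟩ := Nat.dvd_of_mod_eq_zero h5
        rw [hm, hg, Nat.lcm_self, hb, Nat.mul_div_cancel_left _ two_pos]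
        rw [hb] at h h5
        simp only [h, eInd, fInd, h5, and_self, or_true, if_true]
        push_cast
        have : b ≠ 0 := by omega
        field_simp
      · intro y _ hy
        simp [h4, hy]
      · simp
    · have h4 : ¬ minimalPeriod g x % 2 = 1 := by omega
      have h5 : minimalPeriod g x % 2 = 0 := by omega
      simp [h, eInd, fInd, h5]
  have key2 := key.trans (congrArg (1 + ·) (Finset.sum_congr rfl fun x _ => h x))
  rw [sum_minimalPeriod_eq_sum_part g (fun a => (((1 - eInd a) + 2 * fInd a : ℕ) : ℚ) / a)] at key2
  have h6 : ∀ i, (part g.partition i : ℚ) * ((((1 - eInd (part g.partition i)) +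
      2 * fInd (part g.partition i) : ℕ) : ℚ) / (part g.partition i)) =
      ((1 - eInd (part g.partition i)) + 2 * fInd (part g.partition i) : ℕ) := by
    intro i
    have := part_pos g.partition i
    field_simp
  simp only [h6] at key2
  rw [← Nat.cast_sum, add_comm] at key2
  have h7 : ((Nat.card {q // cycleMap (optionCongr (twist g)) q = q} : ℕ) : ℚ) =
    ((eta g.partition + 1 : ℕ) : ℚ) := by rw [key2, eta]; push_cast; rfl
  exact Nat.cast_injective h7

end Orbits

/-! ### Equivalence relations compatible with a permutation of the generators -/

section Compatible

open Function Equiv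

variable {W α : Type*}

/-- Every class of `s` is a union of cycles of `σ`. -/
def FixesClasses (s : Setoid W) (σ : Perm W) : Prop := ∀ w, s w (σ w)

theorem fixesClasses_iff_le (s : Setoid W) (σ : Perm W) :
    FixesClasses s σ ↔ Perm.SameCycle.setoid σ ≤ s := by
  constructor
  · rintro h a b ⟨i, rfl⟩
    induction i with
    | zero => exact s.refl' _
    | succ i ih =>
      refine s.trans' ih ?_
      rw [add_comm, zpow_add, zpow_one]
      exact h _
    | pred i ih =>
      refine s.trans' ih (s.symm' ?_)
      have := h ((σ ^ (-(i : ℤ) - 1)) a)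
      rwa [← Perm.mul_apply, ← zpow_one_add, add_sub_cancel] at this
  · intro h w
    exact h ⟨1, rfl⟩

theorem card_setoid_fixesClasses [Fintype α] [DecidableEq α] (g : Perm α) (N : ℕ) :
    Nat.card {s : Setoid (Option (α × α)) //
        numClasses s = N ∧ FixesClasses s (optionCongr (prodCongr g g))} =
      Nat.stirlingSecond (beta g.partition + 1) N := by
  rw [← card_cycles_prodCongr, ← card_setoid_eq_stirlingSecond]
  have h := card_setoid_ge (Perm.SameCycle.setoid (optionCongr (prodCongr g g))) N
    (fun _ => True)
  simp only [and_true] at h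
  rw [← h]
  simp only [fixesClasses_iff_le]

/-- Pass to the quotient by the cycles of the squared twist, where the twist becomes an involution.
The class of `none` is fixed by it, which supplies the positive number of fixed points that
`card_setoid_involutive` needs. -/
theorem card_setoid_preservedBy_twist [Fintype α] [DecidableEq α] (g : Perm α) (n : ℕ) :
    Nat.card {s : Setoid (Option (α × α)) // numClasses s = n - Fintype.card α ∧
        FixesClasses s ((optionCongr (twist g)) ^ 2) ∧ PreservedBy s (optionCongr (twist g))} =
      selfDualTerm n g.partition := by
  simp only [fixesClasses_iff_le]
  rw [card_setoid_ge _ _ (fun s => PreservedBy s (optionCongr (twist g)))]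
  have h := card_setoid_involutive (cycleMap_involutive (optionCongr (twist g)))
    (card_fixed_cycles_twist g) (card_cycles_twist_sq g) (Nat.succ_pos _) (n - Fintype.card α)
  have h2 : ∀ u : Setoid (Quotient (Perm.SameCycle.setoid ((optionCongr (twist g)) ^ 2))),
      PreservedBy (u.comap (Quotient.mk _)) (optionCongr (twist g)) ↔
        PreservedBy u (cycleMap (optionCongr (twist g))) := by
    intro u
    constructor
    · rintro h ⟨a⟩ ⟨b⟩ hab
      exact h a b hab
    · intro h a b hab
      exact h _ _ hab
  simp only [h2]
  rw [h, selfDualTerm]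
  refine Finset.sum_congr rfl fun j hj => ?_
  have hj' : j ≤ zeta g.partition := Nat.lt_succ_iff.1 (Finset.mem_range.1 hj)
  have : zeta g.partition - j + (eta g.partition + 1) =
      zeta g.partition + eta g.partition - j + 1 := by omega
  rw [this]

/-- The weight is the order of the centralizer of a permutation of this cycle type. The work lies in
treating the parts equal to 1 separately, since `Equiv.Perm.cycleType` omits fixed points. -/
theorem card_partition_mul_weight [Fintype α] [DecidableEq α] (l : (Fintype.card α).Partition) :
    (Finset.univ.filter fun g : Perm α => g.partition = l).card * weight l =
      (Fintype.card α).factorial := by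
  have hsplit : l.parts.filter (2 ≤ ·) + Multiset.replicate (l.parts.count 1) 1 = l.parts := by
    rw [← Multiset.filter_eq']
    conv_rhs => rw [← Multiset.filter_add_not (2 ≤ ·) l.parts]
    congr 1
    refine Multiset.filter_congr fun a ha => ?_
    have := l.parts_pos ha
    omega
  set m := l.parts.filter (2 ≤ ·) with hm
  have hsum : m.sum + l.parts.count 1 = Fintype.card α := by
    have := congrArg Multiset.sum hsplit
    rwa [Multiset.sum_add, Multiset.sum_replicate, l.parts_sum, smul_eq_mul, mul_one] at this
  have h3 : Fintype.card α - m.sum = l.parts.count 1 := by omega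
  have h2 : ∀ a ∈ m, 2 ≤ a := fun a ha => (Multiset.mem_filter.1 ha).2
  have hset : (Finset.univ.filter fun g : Perm α => g.partition = l) =
      Finset.univ.filter fun g : Perm α => g.cycleType = m := by
    ext g
    simp only [Finset.mem_filter, Finset.mem_univ, true_and]
    constructor
    · rintro rfl
      exact Perm.filter_parts_partition_eq_cycleType.symm
    · intro h
      rw [Nat.Partition.ext_iff, Perm.parts_partition, ← Perm.sum_cycleType, h, h3, hsplit]
  have key := Perm.card_of_cycleType_mul_eq α m
  rw [if_pos ⟨by omega, h2⟩, ← hset] at key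
  rw [← key]
  congr 1
  have hcount : ∀ a ∈ m.toFinset, l.parts.count a = m.count a := by
    intro a ha
    rw [hm, Multiset.count_filter_of_pos (h2 a (Multiset.mem_toFinset.1 ha))]
  have h1 : 1 ∉ m.toFinset := fun h => by
    have := h2 1 (Multiset.mem_toFinset.1 h)
    omega
  -- If 1 is not a part, its factor is 1 and does no harm.
  have hw : weight l = ∏ a ∈ insert 1 m.toFinset,
      a ^ l.parts.count a * (l.parts.count a).factorial := by
    refine Finset.prod_subset ?_ ?_
    · intro a ha
      rw [Multiset.mem_toFinset, ← hsplit, Multiset.mem_add] at ha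
      rw [Finset.mem_insert, Multiset.mem_toFinset]
      rcases ha with ha | ha
      · exact Or.inr ha
      · exact Or.inl (Multiset.eq_of_mem_replicate ha)
    · intro a _ ha
      rw [Multiset.mem_toFinset, ← Multiset.count_eq_zero] at ha
      simp [ha]
  rw [hw, Finset.prod_insert h1, one_pow, one_mul, h3, Finset.prod_multiset_count m, mul_assoc,
    ← Finset.prod_mul_distrib]
  congr 1
  exact Finset.prod_congr rfl fun a ha => by rw [hcount a ha]

theorem weight_pos {r : ℕ} (l : r.Partition) : 0 < weight l := by
  refine Finset.prod_pos fun a ha => ?_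
  have := l.parts_pos (Multiset.mem_toFinset.1 ha)
  positivity

theorem sum_partition [Fintype α] [DecidableEq α] (c : (Fintype.card α).Partition → ℕ) :
    ((∑ g : Perm α, c g.partition : ℕ) : ℚ) =
      (Fintype.card α).factorial * ∑ l, (c l : ℚ) / weight l := by
  rw [← Finset.sum_fiberwise (s := Finset.univ) (g := Perm.partition), Finset.mul_sum]
  push_cast
  refine Finset.sum_congr rfl fun l _ => ?_
  have hw := weight_pos l
  rw [← card_partition_mul_weight l, Finset.sum_congr rfl (fun g hg => by
    rw [(Finset.mem_filter.1 hg).2] : ∀ g ∈ Finset.univ.filter (fun g : Perm α => g.partition = l),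
      (c g.partition : ℚ) = c l), Finset.sum_const, nsmul_eq_mul]
  push_cast
  field_simp

end Compatible

/-! ### Semigroups from tables of products of generators -/

section Tables

open Function Equiv

variable {X : Type*} {A : Finset X}

/-- `φ` is an automorphism (`d = false`) or an anti-automorphism (`d = true`) of `S`. -/
def IsMulMap (d : Bool) (S : Semigroup X) (φ : Perm X) : Prop :=
  ∀ x y, φ (S.mul x y) = if d then S.mul (φ y) (φ x) else S.mul (φ x) (φ y)

/-- The action of a permutation of the generators on pairs of generators, with the order of the
pair reversed if `d = true`. -/
def pairPerm (d : Bool) (g : Perm X) : Perm (Option (X × X)) :=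
  optionCongr (if d then twist g else prodCongr g g)

/-- `φ` extends `g`, and acts on the entries of the table `F` as `g` acts on the arguments. -/
def Extends (d : Bool) (F : Option (A × A) → {x // x ∉ A}) (φ : Perm X) (g : Perm A) : Prop :=
  (∀ a : A, φ a = g a) ∧ ∀ w, φ (F w) = F (pairPerm d g w)

theorem Extends.preservedBy {d : Bool} {F : Option (A × A) → {x // x ∉ A}} {φ : Perm X}
    {g : Perm A} (h : Extends d F φ g) : PreservedBy (Setoid.ker F) (pairPerm d g) := by
  intro a b hab
  refine Subtype.ext ?_
  rw [← h.2, ← h.2, show F a = F b from hab]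

theorem Extends.pow_apply {d : Bool} {F : Option (A × A) → {x // x ∉ A}} {φ : Perm X}
    {g : Perm A} (h : Extends d F φ g) (k : ℕ) (w) :
    (φ ^ k) (F w) = F ((pairPerm d g ^ k) w) := by
  induction k with
  | zero => rfl
  | succ k ih => rw [pow_succ', pow_succ', Perm.mul_apply, ih, h.2, Perm.mul_apply]

variable [DecidableEq X]

/-- The multiplication in which the product of two elements `x`, `y` of `A` is `F (some (x, y))`
and all other products are `F none`. -/
def tableMul (F : Option (A × A) → {x // x ∉ A}) (x y : X) : X :=
  if h : x ∈ A ∧ y ∈ A then F (some (⟨x, h.1⟩, ⟨y, h.2⟩)) else F none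

theorem tableMul_coe (F : Option (A × A) → {x // x ∉ A}) (x y : A) :
    tableMul F x y = F (some (x, y)) := by
  simp [tableMul]

theorem tableMul_of_left {F : Option (A × A) → {x // x ∉ A}} {x : X} (hx : x ∉ A) (y : X) :
    tableMul F x y = F none := by
  simp [tableMul, hx]

theorem tableMul_of_right {F : Option (A × A) → {x // x ∉ A}} (x : X) {y : X} (hy : y ∉ A) :
    tableMul F x y = F none := by
  simp [tableMul, hy]

theorem tableMul_notMem (F : Option (A × A) → {x // x ∉ A}) (x y : X) : tableMul F x y ∉ A := by
  unfold tableMul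
  split_ifs
  · exact (F _).2
  · exact (F _).2

/-- The semigroup with multiplication `tableMul F`. -/
abbrev tableSemigroup (F : Option (A × A) → {x // x ∉ A}) : Semigroup X where
  mul := tableMul F
  mul_assoc x y z :=
    (tableMul_of_left (tableMul_notMem F x y) z).trans
      (tableMul_of_right x (tableMul_notMem F y z)).symm

theorem tableSemigroup_mul (F : Option (A × A) → {x // x ∉ A}) :
    (tableSemigroup F).mul = tableMul F := rfl

/-- Surjectivity makes `A` the set of non-products, so that the semigroup determines `A`. -/
theorem exists_tableMul_eq_iff {F : Option (A × A) → {x // x ∉ A}} (hF : Surjective F) (x : X) :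
    (∃ a b, tableMul F a b = x) ↔ x ∉ A := by
  constructor
  · rintro ⟨a, b, rfl⟩
    exact tableMul_notMem F a b
  · intro hx
    obtain ⟨w, hw⟩ := hF ⟨x, hx⟩
    rcases w with _ | ⟨a, b⟩
    -- The zero is the square of any element outside `A`, even if every entry of the table is
    -- nonzero.
    · exact ⟨x, x, by rw [tableMul_of_left hx, hw]⟩
    · exact ⟨a, b, by rw [tableMul_coe, hw]⟩

theorem tableSemigroup_isThreeNilpotent [Fintype X] {F : Option (A × A) → {x // x ∉ A}}
    (hF : Surjective F) (hA : A.card + 2 ≤ Fintype.card X) :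
    @IsThreeNilpotent X (tableSemigroup F) := by
  refine ⟨F none, fun x => ⟨tableMul_of_left (F none).2 x, tableMul_of_right x (F none).2⟩,
    fun x y w => tableMul_of_left (tableMul_notMem F x y) w, ?_⟩
  have hc : 1 < Fintype.card {x // x ∉ A} := by
    rw [Fintype.card_subtype_compl, Fintype.card_coe]
    omega
  have := Fintype.one_lt_card_iff_nontrivial.1 hc
  obtain ⟨b, hb⟩ := exists_ne (F none)
  obtain ⟨w, rfl⟩ := hF b
  rcases w with _ | ⟨x, y⟩
  · exact (hb rfl).elim
  · exact ⟨x, y, fun h => hb (Subtype.ext ((tableMul_coe F x y).symm.trans h))⟩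

/-- Take `A` to be the elements that are not products. A product with a factor outside `A` is a
product of three elements, hence zero. The zero and one nonzero product account for the two elements
outside `A`. -/
theorem exists_tableSemigroup [Fintype X] (S : Semigroup X) (hS : @IsThreeNilpotent X S) :
    ∃ (A : Finset X) (F : Option (A × A) → {x // x ∉ A}),
      A.card + 2 ≤ Fintype.card X ∧ Surjective F ∧ tableSemigroup F = S := by
  classical
  obtain ⟨z, hz, h3, x₀, y₀, h₀⟩ := hS
  let A : Finset X := Finset.univ.filter fun x => ∀ a b : X, a * b ≠ x
  have hA : ∀ x, x ∉ A ↔ ∃ a b : X, a * b = x := by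
    intro x
    simp [A]
  have hzA : z ∉ A := (hA z).2 ⟨z, z, (hz z).1⟩
  have hprod : ∀ a b : X, a ∉ A ∨ b ∉ A → a * b = z := by
    rintro a b (h | h)
    · obtain ⟨c, d, rfl⟩ := (hA a).1 h
      exact h3 c d b
    · obtain ⟨c, d, rfl⟩ := (hA b).1 h
      rw [← mul_assoc]
      exact h3 a c d
  let F : Option (A × A) → {x // x ∉ A} := fun w =>
    w.elim ⟨z, hzA⟩ fun p => ⟨p.1.1 * p.2.1, (hA _).2 ⟨_, _, rfl⟩⟩
  refine ⟨A, F, ?_, ?_, ?_⟩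
  · have hsub : ({z, x₀ * y₀} : Finset X) ⊆ Aᶜ := by
      intro x hx
      rw [Finset.mem_insert, Finset.mem_singleton] at hx
      rw [Finset.mem_compl]
      rcases hx with rfl | rfl
      · exact hzA
      · exact (hA _).2 ⟨_, _, rfl⟩
    have hcard := Finset.card_le_card hsub
    rw [Finset.card_pair h₀.symm, Finset.card_compl] at hcard
    omega
  · rintro ⟨x, hx⟩
    obtain ⟨a, b, rfl⟩ := (hA x).1 hx
    by_cases hab : a ∈ A ∧ b ∈ A
    · exact ⟨some (⟨a, hab.1⟩, ⟨b, hab.2⟩), rfl⟩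
    · exact ⟨none, Subtype.ext (hprod a b (not_and_or.1 hab)).symm⟩
  · refine Semigroup.ext (funext fun x => funext fun y => ?_)
    change tableMul F x y = x * y
    by_cases hxy : x ∈ A ∧ y ∈ A
    · exact tableMul_coe F ⟨x, hxy.1⟩ ⟨y, hxy.2⟩
    · rw [hprod x y (not_and_or.1 hxy), tableMul, dif_neg hxy]
      rfl

theorem tableSemigroup_injective {A' : Finset X} {F : Option (A × A) → {x // x ∉ A}}
    {F' : Option (A' × A') → {x // x ∉ A'}} (hF : Surjective F) (hF' : Surjective F')
    (h : tableSemigroup F = tableSemigroup F') : A = A' ∧ HEq F F' := by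
  have hm : tableMul F = tableMul F' := congrArg (fun S : Semigroup X => S.mul) h
  have hA : A = A' := by
    ext x
    rw [← not_iff_not, ← exists_tableMul_eq_iff hF, ← exists_tableMul_eq_iff hF', hm]
  subst hA
  refine ⟨rfl, heq_of_eq (funext fun w => Subtype.ext ?_)⟩
  rcases w with _ | ⟨a, b⟩
  · rw [← tableMul_of_left (F := F) (F none).2 (F none), hm, tableMul_of_left (F none).2]
  · rw [← tableMul_coe, hm, tableMul_coe]

/-- Three-nilpotent semigroups are the same as tables. -/
theorem tableSemigroup_bijective [Fintype X] : Bijective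
    (fun p : Σ A : {A : Finset X // A.card + 2 ≤ Fintype.card X},
        {F : Option (A.1 × A.1) → {x // x ∉ A.1} // Surjective F} =>
      (⟨tableSemigroup p.2.1, tableSemigroup_isThreeNilpotent p.2.2 p.1.2⟩ :
        {S : Semigroup X // @IsThreeNilpotent X S})) := by
  constructor
  · rintro ⟨⟨A, hA⟩, F, hF⟩ ⟨⟨A', hA'⟩, F', hF'⟩ h
    obtain ⟨rfl, h2⟩ := tableSemigroup_injective hF hF' (congrArg Subtype.val h)
    obtain rfl := eq_of_heq h2
    rfl
  · rintro ⟨S, hS⟩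
    obtain ⟨A, F, hA, hF, rfl⟩ := exists_tableSemigroup S hS
    exact ⟨⟨⟨A, hA⟩, F, hF⟩, rfl⟩

theorem Extends.isMulMap {d : Bool} {F : Option (A × A) → {x // x ∉ A}} (hF : Surjective F)
    {φ : Perm X} {g : Perm A} (h : Extends d F φ g) : IsMulMap d (tableSemigroup F) φ := by
  have hmem : ∀ x, x ∉ A → φ x ∉ A := by
    intro x hx
    obtain ⟨w, hw⟩ := hF ⟨x, hx⟩
    have := h.2 w
    rw [hw] at this
    exact this ▸ (F _).2
  intro x y
  rw [tableSemigroup_mul]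
  by_cases hx : x ∈ A
  · by_cases hy : y ∈ A
    · lift x to A using hx
      lift y to A using hy
      rw [tableMul_coe, h.2, h.1, h.1, tableMul_coe, tableMul_coe]
      cases d <;> rfl
    · rw [tableMul_of_right _ hy, tableMul_of_left (hmem y hy), tableMul_of_right _ (hmem y hy),
        h.2, ite_self]
      rfl
  · rw [tableMul_of_left hx, tableMul_of_left (hmem x hx), tableMul_of_right _ (hmem x hx),
      h.2, ite_self]
    rfl

/-- An (anti-)automorphism permutes the products, hence also the complement `A`, and restricts to
it. -/
theorem IsMulMap.exists_extends {d : Bool} {F : Option (A × A) → {x // x ∉ A}}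
    (hF : Surjective F) {φ : Perm X} (h : IsMulMap d (tableSemigroup F) φ) :
    ∃ g : Perm A, Extends d F φ g := by
  rw [IsMulMap, tableSemigroup_mul] at h
  have hmem : ∀ x, x ∈ A ↔ φ x ∈ A := by
    intro x
    rw [← not_iff_not, ← exists_tableMul_eq_iff hF, ← exists_tableMul_eq_iff hF]
    constructor
    · rintro ⟨a, b, rfl⟩
      rw [h]
      cases d
      · exact ⟨φ a, φ b, rfl⟩
      · exact ⟨φ b, φ a, rfl⟩
    · rintro ⟨a, b, hab⟩
      cases d
      · refine ⟨φ.symm a, φ.symm b, φ.injective ?_⟩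
        rw [h, φ.apply_symm_apply, φ.apply_symm_apply]
        exact hab
      · refine ⟨φ.symm b, φ.symm a, φ.injective ?_⟩
        rw [h, φ.apply_symm_apply, φ.apply_symm_apply]
        exact hab
  refine ⟨φ.subtypePerm fun x => (hmem x).symm, fun a => rfl, ?_⟩
  rintro (_ | ⟨a, b⟩)
  -- The zero is fixed because it is its own square and any square of an element outside `A` is
  -- zero.
  · have hz : φ (F none) ∉ A := fun hz => (F none).2 ((hmem _).2 hz)
    have := h (F none) (F none)
    rw [tableMul_of_left (F none).2, tableMul_of_left hz, ite_self] at this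
    exact this
  · rw [← tableMul_coe, h]
    cases d
    · exact tableMul_coe F ((φ.subtypePerm fun x => (hmem x).symm) a)
        ((φ.subtypePerm fun x => (hmem x).symm) b)
    · exact tableMul_coe F ((φ.subtypePerm fun x => (hmem x).symm) b)
        ((φ.subtypePerm fun x => (hmem x).symm) a)

theorem Extends.fixesClasses_iff {d : Bool} {F : Option (A × A) → {x // x ∉ A}}
    (hF : Surjective F) {φ : Perm X} {g : Perm A} (h : Extends d F φ g) (k : ℕ) :
    FixesClasses (Setoid.ker F) (pairPerm d g ^ k) ↔
      ∀ x y, (φ ^ k) ((tableSemigroup F).mul x y) = (tableSemigroup F).mul x y := by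
  rw [tableSemigroup_mul]
  constructor
  · intro hk x y
    obtain ⟨w, hw⟩ := hF ⟨tableMul F x y, tableMul_notMem F x y⟩
    have h1 := h.pow_apply k w
    rw [← show F w = F ((pairPerm d g ^ k) w) from hk w, hw] at h1
    exact h1
  · intro hk w
    refine Subtype.ext ?_
    rw [← h.pow_apply]
    obtain ⟨a, b, hab⟩ := (exists_tableMul_eq_iff hF (F w : X)).2 (F w).2
    rw [← hab, hk]

theorem exists_extends [Finite X] {d : Bool} {F : Option (A × A) → {x // x ∉ A}}
    (hF : Surjective F) {g : Perm A} (h : PreservedBy (Setoid.ker F) (pairPerm d g)) :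
    ∃ φ : Perm X, Extends d F φ g := by
  -- The action forced on table values; invariance of the kernel makes it independent of the chosen
  -- preimage.
  let ρ₀ : {x // x ∉ A} → {x // x ∉ A} := fun b => F (pairPerm d g (surjInv hF b))
  have hρ : ∀ w, ρ₀ (F w) = F (pairPerm d g w) := fun w => h _ _ (surjInv_eq hF (F w))
  have hs : Surjective ρ₀ := by
    intro b
    obtain ⟨w, rfl⟩ := hF b
    exact ⟨F ((pairPerm d g).symm w), by rw [hρ, apply_symm_apply]⟩
  let ρ : Perm {x // x ∉ A} := Equiv.ofBijective ρ₀ ⟨Finite.injective_iff_surjective.2 hs, hs⟩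
  refine ⟨Perm.subtypeCongr g ρ, fun a => ?_, fun w => ?_⟩
  · exact Perm.subtypeCongr.left_apply_subtype g ρ a
  · rw [Perm.subtypeCongr.right_apply_subtype, ← hρ]
    rfl

theorem Extends.unique {d : Bool} {F : Option (A × A) → {x // x ∉ A}} (hF : Surjective F)
    {φ ψ : Perm X} {g : Perm A} (h : Extends d F φ g) (h' : Extends d F ψ g) : φ = ψ := by
  ext x
  by_cases hx : x ∈ A
  · exact (h.1 ⟨x, hx⟩).trans (h'.1 ⟨x, hx⟩).symm
  · obtain ⟨w, hw⟩ := hF ⟨x, hx⟩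
    have h1 := (h.2 w).trans (h'.2 w).symm
    rwa [hw] at h1

/-- (Anti-)automorphisms of `S` whose `k`-th power fixes all products. -/
def IsMulMapFixing (d : Bool) (k : ℕ) (S : Semigroup X) (φ : Perm X) : Prop :=
  IsMulMap d S φ ∧ ∀ x y, (φ ^ k) (S.mul x y) = S.mul x y

/-- The permutations of generators that induce (anti-)automorphisms whose `k`-th power fixes all
products. -/
def IsCompatible (d : Bool) (k : ℕ) (g : Perm X) (s : Setoid (Option (X × X))) :
    Prop :=
  FixesClasses s (pairPerm d g ^ k) ∧ PreservedBy s (pairPerm d g)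

/-- Restriction to `A` is a bijection: an invariant kernel allows an extension by `exists_extends`,
and surjectivity of `F` makes it unique. -/
theorem card_isMulMapFixing [Finite X] (d : Bool) (k : ℕ) {F : Option (A × A) → {x // x ∉ A}}
    (hF : Surjective F) :
    Nat.card {φ // IsMulMapFixing d k (tableSemigroup F) φ} =
      Nat.card {g : Perm A // IsCompatible d k g (Setoid.ker F)} := by
  symm
  have hex : ∀ g : {g : Perm A // IsCompatible d k g (Setoid.ker F)},
      ∃ φ : Perm X, Extends d F φ g.1 := fun g => exists_extends hF g.2.2
  choose f hf using hex
  refine Nat.card_congr (Equiv.ofBijective (fun g => ⟨f g, (hf g).isMulMap hF,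
    ((hf g).fixesClasses_iff hF k).1 g.2.1⟩) ⟨?_, ?_⟩)
  · intro g g' h
    refine Subtype.ext (Equiv.ext fun a => Subtype.ext ?_)
    rw [← (hf g).1, ← (hf g').1]
    exact congrArg (fun φ => φ.1 (a : X)) h
  · rintro ⟨φ, hφ, hk⟩
    obtain ⟨g, hg⟩ := hφ.exists_extends hF
    refine ⟨⟨g, (hg.fixesClasses_iff hF k).2 hk, hg.preservedBy⟩, Subtype.ext ?_⟩
    exact (hf _).unique hF hg

theorem finite_semigroup_of_finite (X : Type*) [Finite X] : Finite (Semigroup X) :=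
  Finite.of_injective (fun A : Semigroup X => (A.mul : X → X → X)) fun _ _ h => Semigroup.ext h

/-- Pairs of a three-nilpotent semigroup and an (anti-)automorphism, counted through tables. -/
theorem sum_card_isMulMapFixing [Fintype X] {n : ℕ} (hn : Fintype.card X = n) (d : Bool)
    (k : ℕ) :
    ∑ φ : Perm X, Nat.card {S : Semigroup X // @IsThreeNilpotent X S ∧ IsMulMapFixing d k S φ} =
      ∑ A : {A : Finset X // A.card + 2 ≤ n}, (n - A.1.card).factorial *
        ∑ g : Perm A.1, Nat.card {s : Setoid (Option (A.1 × A.1)) //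
          numClasses s = n - A.1.card ∧ IsCompatible d k g s} := by
  classical
  subst hn
  have := finite_semigroup_of_finite X
  have hB : ∀ A : Finset X, Nat.card {x // x ∉ A} = Fintype.card X - A.card := by
    intro A
    rw [Nat.card_eq_fintype_card, Fintype.card_subtype_compl, Fintype.card_coe]
  let T := Σ A : {A : Finset X // A.card + 2 ≤ Fintype.card X},
        {F : Option (A.1 × A.1) → {x // x ∉ A.1} // Surjective F}
  have e : (Σ φ : Perm X, {S : Semigroup X // @IsThreeNilpotent X S ∧ IsMulMapFixing d k S φ}) ≃
      Σ p : T, {φ // IsMulMapFixing d k (tableSemigroup p.2.1) φ} :=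
    { toFun := fun p => ⟨⟨p.2.1, p.2.2.1⟩, p.1, p.2.2.2⟩
      invFun := fun p => ⟨p.2.1, p.1.1, p.1.2, p.2.2⟩
      left_inv := fun _ => rfl
      right_inv := fun _ => rfl : _ ≃ Σ S : {S : Semigroup X // @IsThreeNilpotent X S},
        {φ // IsMulMapFixing d k S.1 φ}}.trans
      (Equiv.sigmaCongrLeft (Equiv.ofBijective _ tableSemigroup_bijective)).symm
  have hT : ∀ A : {A : Finset X // A.card + 2 ≤ Fintype.card X},
      Fintype {F : Option (A.1 × A.1) → {x // x ∉ A.1} // Surjective F} :=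
    fun A => Fintype.ofFinite _
  let _ : Fintype T := Sigma.instFintype
  rw [← Nat.card_sigma, Nat.card_congr e, Nat.card_sigma]
  have h1 : ∀ p : T, Nat.card {φ // IsMulMapFixing d k (tableSemigroup p.2.1) φ} =
      Nat.card {g : Perm p.1.1 // IsCompatible d k g (Setoid.ker p.2.1)} :=
    fun p => card_isMulMapFixing d k p.2.2
  rw [Finset.sum_congr rfl fun p _ => h1 p]
  have h2 : ∑ p : T, Nat.card {g : Perm p.1.1 // IsCompatible d k g (Setoid.ker p.2.1)} =
      ∑ A : {A : Finset X // A.card + 2 ≤ Fintype.card X},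
        ∑ F : {F : Option (A.1 × A.1) → {x // x ∉ A.1} // Surjective F},
          Nat.card {g : Perm A.1 // IsCompatible d k g (Setoid.ker F.1)} := by
    rw [← Fintype.sum_sigma']
  rw [h2]
  refine Finset.sum_congr rfl fun A _ => ?_
  rw [← Nat.card_sigma, Finset.mul_sum]
  -- The factorial counts the labellings of the classes of a kernel by the elements outside `A`.
  have h3 : ∀ g : Perm A.1, (Fintype.card X - A.1.card).factorial *
      Nat.card {s : Setoid (Option (A.1 × A.1)) //
          numClasses s = Fintype.card X - A.1.card ∧ IsCompatible d k g s} =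
      Nat.card {F : Option (A.1 × A.1) → {x // x ∉ A.1} //
        Surjective F ∧ IsCompatible d k g (Setoid.ker F)} := by
    intro g
    rw [card_surjective_ker (fun s => IsCompatible d k g s), hB]
  rw [Finset.sum_congr rfl fun g _ => h3 g, ← Nat.card_sigma]
  exact Nat.card_congr
    { toFun := fun p => ⟨p.2.1, p.1.1, p.1.2, p.2.2⟩
      invFun := fun p => ⟨⟨p.2.1, p.2.2.1⟩, p.1, p.2.2.2⟩
      left_inv := fun _ => rfl
      right_inv := fun _ => rfl }

end Tables

/-! ### Orbit counting -/

section Burnside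

open Function Equiv

variable {X : Type*}

/-- Transport of a semigroup structure along a permutation, with the factors exchanged if the
sign is `-1`. -/
abbrev transport (p : Perm X × ℤˣ) (S : Semigroup X) : Semigroup X where
  mul x y := p.1 (if p.2 = 1 then S.mul (p.1.symm x) (p.1.symm y)
    else S.mul (p.1.symm y) (p.1.symm x))
  mul_assoc x y z := by
    have h : ∀ a b c, S.mul (S.mul a b) c = S.mul a (S.mul b c) := S.mul_assoc
    change p.1 _ = p.1 _
    congr 1
    by_cases hp : p.2 = 1
    · simp only [hp, if_true]
      change S.mul (p.1.symm (p.1 (if _ then _ else _))) _ =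
        S.mul _ (p.1.symm (p.1 (if _ then _ else _)))
      rw [if_pos hp, if_pos hp, symm_apply_apply, symm_apply_apply, h]
    · simp only [hp, if_false]
      change S.mul _ (p.1.symm (p.1 (if _ then _ else _))) =
        S.mul (p.1.symm (p.1 (if _ then _ else _))) _
      rw [if_neg hp, if_neg hp, symm_apply_apply, symm_apply_apply, h]

theorem transport_one_mul (φ : Perm X) (S : Semigroup X) (x y : X) :
    (transport (φ, 1) S).mul x y = φ (S.mul (φ.symm x) (φ.symm y)) := rfl

theorem transport_neg_mul (φ : Perm X) (S : Semigroup X) (x y : X) :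
    (transport (φ, -1) S).mul x y = φ (S.mul (φ.symm y) (φ.symm x)) := rfl

/-- The action of permutations and signs by `transport`. -/
abbrev transportAction (X : Type*) : MulAction (Perm X × ℤˣ) (Semigroup X) where
  smul := transport
  one_smul S := Semigroup.ext rfl
  mul_smul := by
    rintro ⟨φ, ε⟩ ⟨ψ, δ⟩ S
    refine Semigroup.ext ?_
    rcases Int.units_eq_one_or ε with rfl | rfl <;> rcases Int.units_eq_one_or δ with rfl | rfl <;>
      rfl

theorem transport_eq_self_iff_one (φ : Perm X) (S : Semigroup X) :
    transport (φ, 1) S = S ↔ IsMulMap false S φ := by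
  constructor
  · intro h x y
    have := congrArg (fun T : Semigroup X => T.mul (φ x) (φ y)) h
    simpa [transport_one_mul] using this
  · intro h
    refine Semigroup.ext (funext fun x => funext fun y => ?_)
    have := h (φ.symm x) (φ.symm y)
    rw [φ.apply_symm_apply, φ.apply_symm_apply] at this
    exact this

theorem transport_eq_self_iff_neg (φ : Perm X) (S : Semigroup X) :
    transport (φ, -1) S = S ↔ IsMulMap true S φ := by
  constructor
  · intro h x y
    have := congrArg (fun T : Semigroup X => T.mul (φ y) (φ x)) h
    simpa [transport_neg_mul] using this
  · intro h
    refine Semigroup.ext (funext fun x => funext fun y => ?_)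
    have := h (φ.symm y) (φ.symm x)
    rw [φ.apply_symm_apply, φ.apply_symm_apply] at this
    exact this

theorem areEquivalent_iff {S T : Type*} [Semigroup S] [Semigroup T] :
    AreEquivalent S T ↔ (∃ e : S ≃ T, ∀ x y, e (x * y) = e x * e y) ∨
      ∃ e : S ≃ T, ∀ x y, e (x * y) = e y * e x := by
  constructor
  · rintro (⟨⟨f⟩⟩ | ⟨⟨f⟩⟩)
    · exact Or.inl ⟨f.toEquiv, f.map_mul'⟩
    · exact Or.inr ⟨f.toEquiv.trans MulOpposite.opEquiv.symm, fun x y =>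
        congrArg MulOpposite.unop (f.map_mul' x y)⟩
  · rintro (⟨e, he⟩ | ⟨e, he⟩)
    · exact Or.inl ⟨⟨e, he⟩⟩
    · exact Or.inr ⟨⟨e.trans MulOpposite.opEquiv, fun x y => congrArg MulOpposite.op (he x y)⟩⟩

theorem areEquivalent_iff_exists_transport (S T : Semigroup X) :
    @AreEquivalent X X S T ↔ ∃ p, transport p S = T := by
  rw [@areEquivalent_iff X X S T]
  constructor
  · rintro (⟨e, he⟩ | ⟨e, he⟩)
    · refine ⟨(e, 1), Semigroup.ext (funext fun x => funext fun y => ?_)⟩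
      have h := he (e.symm x) (e.symm y)
      rw [e.apply_symm_apply, e.apply_symm_apply] at h
      exact h
    · refine ⟨(e, -1), Semigroup.ext (funext fun x => funext fun y => ?_)⟩
      have h := he (e.symm y) (e.symm x)
      rw [e.apply_symm_apply, e.apply_symm_apply] at h
      exact h
  · rintro ⟨⟨φ, ε⟩, rfl⟩
    rcases Int.units_eq_one_or ε with rfl | rfl
    · refine Or.inl ⟨φ, fun x y => ?_⟩
      refine Eq.trans ?_ (transport_one_mul φ S (φ x) (φ y)).symm
      rw [φ.symm_apply_apply, φ.symm_apply_apply]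
      rfl
    · refine Or.inr ⟨φ, fun x y => ?_⟩
      refine Eq.trans ?_ (transport_neg_mul φ S (φ y) (φ x)).symm
      rw [φ.symm_apply_apply, φ.symm_apply_apply]
      rfl

theorem IsThreeNilpotent.of_areEquivalent {S T : Type*} [Semigroup S] [Semigroup T]
    (h : AreEquivalent S T) (hS : IsThreeNilpotent S) : IsThreeNilpotent T := by
  obtain ⟨z, hz, h3, x₀, y₀, h₀⟩ := hS
  rcases areEquivalent_iff.1 h with ⟨e, he⟩ | ⟨e, he⟩
  · refine ⟨e z, fun x => ?_, fun x y w => ?_, e x₀, e y₀, ?_⟩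
    · obtain ⟨x, rfl⟩ := e.surjective x
      rw [← he, ← he, (hz x).1, (hz x).2]
      exact ⟨rfl, rfl⟩
    · obtain ⟨x, rfl⟩ := e.surjective x
      obtain ⟨y, rfl⟩ := e.surjective y
      obtain ⟨w, rfl⟩ := e.surjective w
      rw [← he, ← he, h3]
    · rw [← he]
      exact fun h => h₀ (e.injective h)
  · refine ⟨e z, fun x => ?_, fun x y w => ?_, e y₀, e x₀, ?_⟩
    · obtain ⟨x, rfl⟩ := e.surjective x
      rw [← he, ← he, (hz x).1, (hz x).2]
      exact ⟨rfl, rfl⟩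
    · obtain ⟨x, rfl⟩ := e.surjective x
      obtain ⟨y, rfl⟩ := e.surjective y
      obtain ⟨w, rfl⟩ := e.surjective w
      rw [← he, ← he, ← mul_assoc, h3]
    · rw [← he]
      exact fun h => h₀ (e.injective h)

theorem IsSemirigid.of_areEquivalent {S T : Type*} [Semigroup S] [Semigroup T]
    (h : AreEquivalent S T) (hS : IsSemirigid S) : IsSemirigid T := by
  intro φ x y
  rcases areEquivalent_iff.1 h with ⟨e, he⟩ | ⟨e, he⟩
  · have he' : ∀ x y, e.symm (x * y) = e.symm x * e.symm y := fun x y => by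
      rw [e.symm_apply_eq, he, e.apply_symm_apply, e.apply_symm_apply]
    let ψ : S ≃* S := ⟨(e.trans φ.toEquiv).trans e.symm, fun x y => by
      change e.symm (φ (e (x * y))) = e.symm (φ (e x)) * e.symm (φ (e y))
      rw [he, map_mul, he']⟩
    have := congrArg e (hS ψ (e.symm x) (e.symm y))
    rw [← he', e.apply_symm_apply] at this
    change e (e.symm (φ (e (e.symm (x * y))))) = _ at this
    rwa [e.apply_symm_apply, e.apply_symm_apply] at this
  · have he' : ∀ x y, e.symm (x * y) = e.symm y * e.symm x := fun x y => by
      rw [e.symm_apply_eq, he, e.apply_symm_apply, e.apply_symm_apply]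
    let ψ : S ≃* S := ⟨(e.trans φ.toEquiv).trans e.symm, fun x y => by
      change e.symm (φ (e (x * y))) = e.symm (φ (e x)) * e.symm (φ (e y))
      rw [he, map_mul, he']⟩
    have := congrArg e (hS ψ (e.symm y) (e.symm x))
    rw [← he', e.apply_symm_apply] at this
    change e (e.symm (φ (e (e.symm (x * y))))) = _ at this
    rwa [e.apply_symm_apply, e.apply_symm_apply] at this

/-- Orbit counting for a class of semigroups that is closed under equivalence. -/
theorem card_quotient_mul (n : ℕ) (P : Semigroup (Fin n) → Prop)
    (hP : ∀ S T, @AreEquivalent (Fin n) (Fin n) S T → P S → P T) :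
    Nat.card (Quotient ((equivalenceSetoid n).comap
      (Subtype.val : {S : Semigroup (Fin n) // P S} → Semigroup (Fin n)))) * (2 * n.factorial) =
      ∑ φ : Perm (Fin n), Nat.card {S : Semigroup (Fin n) // P S ∧ IsMulMap false S φ} +
        ∑ φ : Perm (Fin n), Nat.card {S : Semigroup (Fin n) // P S ∧ IsMulMap true S φ} := by
  classical
  let _ := transportAction (Fin n)
  let M : SubMulAction (Perm (Fin n) × ℤˣ) (Semigroup (Fin n)) :=
    { carrier := {S | P S}
      smul_mem' := fun p S hS =>
        hP S _ ((areEquivalent_iff_exists_transport S _).2 ⟨p, rfl⟩) hS }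
  let e : {S : Semigroup (Fin n) // P S} ≃ M := Equiv.refl _
  have eq : Quotient ((equivalenceSetoid n).comap
      (Subtype.val : {S : Semigroup (Fin n) // P S} → Semigroup (Fin n))) ≃
      Quotient (MulAction.orbitRel (Perm (Fin n) × ℤˣ) M) := by
    refine Quotient.congr e fun S T => ?_
    have h1 : ((equivalenceSetoid n).comap
      (Subtype.val : {S : Semigroup (Fin n) // P S} → Semigroup (Fin n))) S T ↔
        @AreEquivalent (Fin n) (Fin n) S.1 T.1 := Iff.rfl
    -- The orbit relation moves its second argument to its first, so equivalence is reversed before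
    -- comparing.
    refine h1.trans (Iff.trans ⟨fun h => @AreEquivalent.symm (Fin n) (Fin n) S.1 T.1 h,
      fun h => @AreEquivalent.symm (Fin n) (Fin n) T.1 S.1 h⟩
      ((areEquivalent_iff_exists_transport T.1 S.1).trans ?_))
    refine exists_congr fun p => ?_
    exact ⟨fun h => Subtype.ext h, fun h => congrArg Subtype.val h⟩
  have : ∀ p : Perm (Fin n) × ℤˣ, Fintype (MulAction.fixedBy M p) := fun p => Fintype.ofFinite _
  have : Fintype (Quotient (MulAction.orbitRel (Perm (Fin n) × ℤˣ) M)) := Fintype.ofFinite _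
  have key := MulAction.sum_card_fixedBy_eq_card_orbits_mul_card_group (Perm (Fin n) × ℤˣ) M
  have hG : Fintype.card (Perm (Fin n) × ℤˣ) = 2 * n.factorial := by
    rw [Fintype.card_prod, Fintype.card_perm, Fintype.card_fin, Fintype.card_units_int, mul_comm]
  have hfix : ∀ p : Perm (Fin n) × ℤˣ, Fintype.card (MulAction.fixedBy M p) =
      Nat.card {S : Semigroup (Fin n) // P S ∧ transport p S = S} := by
    intro p
    rw [← Nat.card_eq_fintype_card]
    exact Nat.card_congr
      { toFun := fun S => ⟨S.1.1, S.1.2, congrArg Subtype.val S.2⟩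
        invFun := fun S => ⟨⟨S.1, S.2.1⟩, Subtype.ext S.2.2⟩
        left_inv := fun _ => rfl
        right_inv := fun _ => rfl }
  rw [Nat.card_congr eq, Nat.card_eq_fintype_card, ← hG]
  refine key.symm.trans ?_
  simp only [hfix]
  rw [Fintype.sum_prod_type, ← Finset.sum_add_distrib]
  refine Finset.sum_congr rfl fun φ _ => ?_
  rw [UnitsInt.univ, Finset.sum_pair (by decide)]
  simp only [transport_eq_self_iff_one, transport_eq_self_iff_neg]

end Burnside

/-! ### Evaluating the restricted count and comparing it with the orbit counts -/

section Main

open Function Equiv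

theorem card_subtype_mono {α : Type*} [Finite α] {p q : α → Prop} (h : ∀ a, p a → q a) :
    Nat.card {a // p a} ≤ Nat.card {a // q a} :=
  Nat.card_le_card_of_injective _ (Subtype.impEmbedding p q h).injective

/-- A permutation that moves every point within its class automatically preserves the relation. -/
theorem isCompatible_false_one {X : Type*} (g : Perm X) (s : Setoid (Option (X × X))) :
    IsCompatible false 1 g s ↔ FixesClasses s (optionCongr (prodCongr g g)) := by
  constructor
  · intro h
    exact h.1
  · intro h
    exact ⟨h, fun a b hab => s.trans' (s.symm' (h a)) (s.trans' hab (h b))⟩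

/-- The numerator of the summand of `bound`. -/
noncomputable def numerator (n : ℕ) {r : ℕ} (l : r.Partition) : ℕ :=
  Nat.stirlingSecond (beta l + 1) (n - r) + selfDualTerm n l

theorem sum_card_isCompatible {α : Type*} [Fintype α] [DecidableEq α] {r : ℕ}
    (hr : Fintype.card α = r) (n : ℕ) :
    ((∑ g : Perm α, (Nat.card {s : Setoid (Option (α × α)) //
          numClasses s = n - r ∧ IsCompatible false 1 g s} +
        Nat.card {s : Setoid (Option (α × α)) //
          numClasses s = n - r ∧ IsCompatible true 2 g s}) : ℕ) : ℚ) =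
      (r.factorial : ℚ) *
        ∑ l : r.Partition, (numerator n l : ℚ) / weight l := by
  subst hr
  rw [← sum_partition (numerator n)]
  congr 1
  refine Finset.sum_congr rfl fun g _ => ?_
  simp only [isCompatible_false_one]
  rw [card_setoid_fixesClasses, numerator, ← card_setoid_preservedBy_twist]
  rfl

/-- Without generators only the point `none` remains. This is why the sum over r may start at 1. -/
theorem card_setoid_eq_zero_of_isEmpty {α : Type*} [IsEmpty α] {n : ℕ} (hn : 2 ≤ n)
    (P : Setoid (Option (α × α)) → Prop) :
    Nat.card {s : Setoid (Option (α × α)) // numClasses s = n ∧ P s} = 0 := by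
  have : IsEmpty {s : Setoid (Option (α × α)) // numClasses s = n ∧ P s} := by
    refine ⟨fun s => ?_⟩
    have h := numClasses_le s.1
    rw [Finite.card_option, Nat.card_of_isEmpty, s.2.1] at h
    omega
  exact Nat.card_of_isEmpty

/-- The number of pairs of a three-nilpotent semigroup and a permutation that is either an
automorphism fixing all products or an anti-automorphism whose square fixes all products. -/
theorem sum_card_eq_bound (n : ℕ) :
    ((∑ φ : Perm (Fin n), Nat.card {S : Semigroup (Fin n) //
          @IsThreeNilpotent (Fin n) S ∧ IsMulMapFixing false 1 S φ} +
        ∑ φ : Perm (Fin n), Nat.card {S : Semigroup (Fin n) //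
          @IsThreeNilpotent (Fin n) S ∧ IsMulMapFixing true 2 S φ} : ℕ) : ℚ) =
      bound n * (2 * n.factorial) := by
  classical
  rw [sum_card_isMulMapFixing (Fintype.card_fin n),
    sum_card_isMulMapFixing (Fintype.card_fin n), ← Finset.sum_add_distrib]
  simp only [← mul_add, ← Finset.sum_add_distrib]
  let D : ℕ → ℚ := fun r => ∑ l : r.Partition, (numerator n l : ℚ) / weight l
  let f : Finset (Fin n) → ℕ := fun A => (n - A.card).factorial *
    ∑ g : Perm A, (Nat.card {s : Setoid (Option (A × A)) //
          numClasses s = n - A.card ∧ IsCompatible false 1 g s} +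
        Nat.card {s : Setoid (Option (A × A)) //
          numClasses s = n - A.card ∧ IsCompatible true 2 g s})
  have hf : ∀ A, (f A : ℚ) = ((n - A.card).factorial * A.card.factorial : ℕ) * D A.card := by
    intro A
    have h := sum_card_isCompatible (Fintype.card_coe A) n
    simp only [f]
    rw [Nat.cast_mul, h, Nat.cast_mul, mul_assoc]
  have hf0 : ∀ A : Finset (Fin n), A.card + 2 ≤ n → A.card = 0 → f A = 0 := by
    intro A hA h0
    have : IsEmpty A := by
      rw [Finset.card_eq_zero] at h0
      subst h0
      infer_instance
    simp only [f]
    have h2 : 2 ≤ n - A.card := by omega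
    simp only [card_setoid_eq_zero_of_isEmpty h2]
    simp
  have h1 : ∑ A : {A : Finset (Fin n) // A.card + 2 ≤ n}, f A.1 =
      ∑ A ∈ Finset.univ.filter (fun A : Finset (Fin n) => A.card ∈ Finset.Icc 1 (n - 2)), f A := by
    rw [← Finset.sum_subtype (Finset.univ.filter fun A : Finset (Fin n) => A.card + 2 ≤ n)
      (fun A => by simp) f]
    symm
    refine Finset.sum_subset ?_ ?_
    · intro A
      simp only [Finset.mem_filter, Finset.mem_univ, true_and, Finset.mem_Icc]
      omega
    · intro A
      simp only [Finset.mem_filter, Finset.mem_univ, true_and, Finset.mem_Icc]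
      intro hA h
      exact hf0 A hA (by omega)
  change ((∑ A : {A : Finset (Fin n) // A.card + 2 ≤ n}, f A.1 : ℕ) : ℚ) = _
  rw [h1, ← Finset.sum_fiberwise_of_maps_to (t := Finset.Icc 1 (n - 2)) (g := Finset.card)
    (fun A hA => (Finset.mem_filter.1 hA).2), bound, Finset.sum_mul]
  push_cast
  refine Finset.sum_congr rfl fun r hr => ?_
  have hr' := Finset.mem_Icc.1 hr
  have hset : (Finset.univ.filter (fun A : Finset (Fin n) => A.card ∈ Finset.Icc 1 (n - 2))).filter
      (fun A => A.card = r) = Finset.powersetCard r Finset.univ := by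
    ext A
    simp only [Finset.mem_filter, Finset.mem_univ, true_and, Finset.mem_powersetCard,
      Finset.subset_univ]
    exact ⟨fun h => h.2, fun h => ⟨h ▸ hr, h⟩⟩
  rw [hset, Finset.sum_congr rfl (fun A hA => by
    rw [hf, (Finset.mem_powersetCard.1 hA).2] :
      ∀ A ∈ Finset.powersetCard r (Finset.univ : Finset (Fin n)),
        (f A : ℚ) = ((n - r).factorial * r.factorial : ℕ) * D r),
    Finset.sum_const, Finset.card_powersetCard, Finset.card_univ, Fintype.card_fin, nsmul_eq_mul,
    ← mul_assoc, ← Nat.cast_mul]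
  -- The choice of `A`, the labelling of its complement and the permutations of `A` together give
  -- n!.
  have hc : n.choose r * ((n - r).factorial * r.factorial) = n.factorial := by
    rw [← Nat.choose_mul_factorial_mul_factorial (show r ≤ n by omega)]
    ring
  rw [hc, Finset.sum_mul, Finset.mul_sum]
  refine Finset.sum_congr rfl fun l _ => ?_
  have hw := weight_pos l
  rw [numerator]
  push_cast
  field_simp

theorem IsMulMap.fixing_of_isSemirigid {X : Type*} {S : Semigroup X} (hS : @IsSemirigid X S)
    {φ : Perm X} (h : IsMulMap false S φ) : IsMulMapFixing false 1 S φ :=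
  ⟨h, fun x y => hS ⟨φ, h⟩ x y⟩

theorem IsMulMap.sq_fixing_of_isSemirigid {X : Type*} {S : Semigroup X} (hS : @IsSemirigid X S)
    {φ : Perm X} (h : IsMulMap true S φ) : IsMulMapFixing true 2 S φ := by
  refine ⟨h, fun x y => hS ⟨φ ^ 2, fun x y => ?_⟩ x y⟩
  have h1 : φ (S.mul x y) = S.mul (φ y) (φ x) := h x y
  have h2 : φ (S.mul (φ y) (φ x)) = S.mul (φ (φ x)) (φ (φ y)) := h _ _
  exact (congrArg φ h1).trans h2

end Main

end NilpotentSemigroups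

open NilpotentSemigroups

theorem mainTheorem3 (n : ℕ) :
    (NilpotentSemigroups.numSemirigidThreeNilpotent n : ℚ) ≤ NilpotentSemigroups.bound n ∧
      NilpotentSemigroups.bound n ≤ (NilpotentSemigroups.numThreeNilpotent n : ℚ) := by
  have hpos : (0 : ℚ) < 2 * n.factorial := by positivity
  have hE := sum_card_eq_bound n
  have h1 := card_quotient_mul n
    (fun S => @IsThreeNilpotent (Fin n) S ∧ @IsSemirigid (Fin n) S) (fun S T h hS =>
      ⟨@IsThreeNilpotent.of_areEquivalent (Fin n) (Fin n) S T h hS.1,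
        @IsSemirigid.of_areEquivalent (Fin n) (Fin n) S T h hS.2⟩)
  have h2 := card_quotient_mul n (fun S => @IsThreeNilpotent (Fin n) S) (fun S T h hS =>
      @IsThreeNilpotent.of_areEquivalent (Fin n) (Fin n) S T h hS)
  constructor
  · refine le_of_mul_le_mul_right ?_ hpos
    rw [← hE]
    refine le_trans (le_of_eq (by
      rw [numSemirigidThreeNilpotent]; exact_mod_cast h1)) (Nat.cast_le.2 ?_)
    refine Nat.add_le_add (Finset.sum_le_sum fun φ _ => ?_) (Finset.sum_le_sum fun φ _ => ?_)
    · exact card_subtype_mono fun S hS => ⟨hS.1.1, hS.2.fixing_of_isSemirigid hS.1.2⟩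
    · exact card_subtype_mono fun S hS => ⟨hS.1.1, hS.2.sq_fixing_of_isSemirigid hS.1.2⟩
  · refine le_of_mul_le_mul_right ?_ hpos
    rw [← hE]
    refine le_trans (Nat.cast_le.2 ?_) (le_of_eq (by
      rw [numThreeNilpotent]; exact_mod_cast h2.symm))
    refine Nat.add_le_add (Finset.sum_le_sum fun φ _ => ?_) (Finset.sum_le_sum fun φ _ => ?_)
    · exact card_subtype_mono fun S hS => ⟨hS.1, hS.2.1⟩
    · exact card_subtype_mono fun S hS => ⟨hS.1, hS.2.1⟩
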